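/- Theorem 7.3. Let $\Lambda=\mathbb C[\mathbf p_1,\mathbf p_2,\dots]$ be the algebra of symmetric functions over $\mathbb C$, with $\mathbf p_k$ the power sums, and let $h_k\in\Lambda$ be given by $1+\sum_{k\ge1}h_kt^k=\exp\bigl(\sum_{k\ge1}\mathbf p_k t^k/k\bigr)$, $h_k=0$ for $k<0$. For $x_1,\dots,x_m,y_1,\dots,y_n\in\mathbb C$ let $f(x_1,\dots,x_m;y_1,\dots,y_n)$ be the value of $f\in\Lambda$ at $\mathbf p_k=\sum_i x_i^k+(-1)^{k-1}\sum_i y_i^k$. For a sequence $a=(a_i)_{i\in\mathbb Z}$ of complex numbers put $(\tau^ra)_i=a_{i+r}$ and $\widehat a_i=-a_{-i+1}$; let $h_{k;a}\in\Lambda$ be defined by the identity of formal series in $u^{-1}$ $$1+\sum_{k\ge1}\frac{h_{k;a}}{(u-a_1)\cdots(u-a_k)}=1+\sum_{k\ge1}\frac{h_k}{u^k},$$ with $h_{0;a}=1$ and $h_{k;a}=0$ for $k<0$; and for a Young diagram $\mu$ with $\ell$ rows let $s_{\mu;a}=\det[h_{\mu_i-i+j;\,\tau^{1-j}a}]_{i,j=1}^{\ell}$.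 Let $d(\mu)$ be the number of diagonal squares of $\mu$, and write $\mu=(p_1,\dots,p_d\,|\,q_1,\dots,q_d)$ in Frobenius coordinates, $d=d(\mu)$, $p_i=\mu_i-i$, $q_i=\mu'_i-i$, where $\mu'$ is the conjugate diagram. Let $a$ and $b$ be two sequences $(a_i)_{i\in\mathbb Z}$, $(b_i)_{i\in\mathbb Z}$ of complex numbers and let $\mu$ be a Young diagram. Then there is a unique finite expansion $$s_{\mu;a}=\sum_\nu c_{\mu\nu}(a,b)\,s_{\nu;b},\qquad c_{\mu\nu}(a,b)\in\mathbb C,$$ over Young diagrams $\nu$. Its coefficients vanish unless $\nu\subseteq\mu$ and $d(\nu)=d(\mu)$. If $d(\nu)=d(\mu)=d$ and $\mu=(p_1,\dots,p_d\,|\,q_1,\dots,q_d)$, $\nu=(p'_1,\dots,p'_d\,|\,q'_1,\dots,q'_d)$, then $$c_{\mu\nu}(a,b)=\det[c_{p_i,p'_j}(a,b)]_{i,j=1}^d\cdot\det[c_{q_i,q'_j}(\widehat a,\widehat b)]_{i,j=1}^d,$$ where $c_{pp'}(a,b)=h_{p-p'}(b_1,\dots,b_{p'+1};-a_1,\dots,-a_p)$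 (in particular $c_{pp'}(a,b)=0$ for $p<p'$). -/

import Mathlib

noncomputable section

namespace MultiSchur

/-- The algebra `Λ` of symmetric functions over `ℂ`: the polynomial algebra `ℂ[p₁, p₂, …]`
in the power sums; the variable `X k` is `p_k`. -/
abbrev SymFun : Type := MvPolynomial ℕ+ ℂ

/-- The formal series `∑_{k ≥ 1} p_k t^k / k`. -/
def powerSumSeries : PowerSeries SymFun :=
  PowerSeries.mk fun k : ℕ =>
    if hk : 0 < k then (k : ℂ)⁻¹ • (MvPolynomial.X (⟨k, hk⟩ : ℕ+) : SymFun) else 0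

theorem hasSubst_powerSumSeries : PowerSeries.HasSubst powerSumSeries := by
  apply PowerSeries.HasSubst.of_constantCoeff_zero'
  rw [← PowerSeries.coeff_zero_eq_constantCoeff_apply, powerSumSeries, PowerSeries.coeff_mk]
  simp

/-- The generating series `H = 1 + ∑_{k ≥ 1} h_k t^k = exp (∑_{k ≥ 1} p_k t^k / k)`. -/
def completeSeries : PowerSeries SymFun :=
  (PowerSeries.exp SymFun).subst powerSumSeries

/-- The complete homogeneous symmetric function `h_k`. -/
def complete (k : ℕ) : SymFun := PowerSeries.coeff k completeSeries

/-- The value `f(x₁, …, x_m; y₁, …, y_n)` in the super realization of `Λ`: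
`p_k ↦ ∑ x_i ^ k + (-1) ^ (k - 1) ∑ y_i ^ k`. -/
def superEval {m n : ℕ} (x : Fin m → ℂ) (y : Fin n → ℂ) : SymFun →ₐ[ℂ] ℂ :=
  MvPolynomial.aeval fun k : ℕ+ =>
    ∑ i, x i ^ (k : ℕ) + (-1) ^ ((k : ℕ) - 1) * ∑ i, y i ^ (k : ℕ)

/-- The expansion of `1 / ((u - a₁) ⋯ (u - a_k))` as a formal series in `t = u⁻¹`, that is,
`t ^ k / ((1 - a₁ t) ⋯ (1 - a_k t))`. -/
def invFactorialPower (a : ℤ → ℂ) (k : ℕ) : PowerSeries ℂ :=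
  PowerSeries.X ^ k *
    ∏ i ∈ Finset.range k, (1 - PowerSeries.C (a ((i : ℤ) + 1)) * PowerSeries.X)⁻¹

/-- The one-row multiparameter Schur function `h_{k;a}`, obtained by solving
`1 + ∑_{k ≥ 1} h_{k;a} / ((u - a₁) ⋯ (u - a_k)) = 1 + ∑_{k ≥ 1} h_k / u ^ k`
recursively; see `eq_rowNat_iff`. -/
def rowNat (a : ℤ → ℂ) (n : ℕ) : SymFun :=
  complete n - ∑ k : Fin n, PowerSeries.coeff n (invFactorialPower a k) • rowNat a k
termination_by n
decreasing_by exact k.isLt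

theorem coeff_invFactorialPower_self (a : ℤ → ℂ) (n : ℕ) :
    PowerSeries.coeff n (invFactorialPower a n) = 1 := by
  rw [invFactorialPower, PowerSeries.coeff_X_pow_mul', if_pos le_rfl, Nat.sub_self,
    PowerSeries.coeff_zero_eq_constantCoeff_apply, map_prod]
  simp

theorem coeff_invFactorialPower_of_lt (a : ℤ → ℂ) {n k : ℕ} (h : n < k) :
    PowerSeries.coeff n (invFactorialPower a k) = 0 := by
  rw [invFactorialPower, PowerSeries.coeff_X_pow_mul', if_neg (by omega)]

/-- The sequence `(h_{k;a})_k` is the unique one for which the coefficients of `u⁻ⁿ` in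
`∑_{k ≥ 0} h_{k;a} / ((u - a₁) ⋯ (u - a_k))` and in `∑_{k ≥ 0} h_k / u ^ k` agree for every `n`
(the terms with `k > n` do not contribute). -/
theorem eq_rowNat_iff (a : ℤ → ℂ) (g : ℕ → SymFun) :
    g = rowNat a ↔ ∀ n : ℕ, ∑ k ∈ Finset.range (n + 1),
      PowerSeries.coeff n (invFactorialPower a k) • g k = complete n := by
  constructor
  · rintro rfl n
    rw [Finset.sum_range_succ, coeff_invFactorialPower_self, one_smul]
    conv_lhs => rw [rowNat]
    rw [Finset.sum_range (fun k => PowerSeries.coeff n (invFactorialPower a k) • rowNat a k)]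
    abel
  · intro h
    funext n
    induction n using Nat.strong_induction_on with
    | _ n ih =>
      have := h n
      rw [Finset.sum_range_succ, coeff_invFactorialPower_self, one_smul] at this
      rw [rowNat, ← this, Finset.sum_range]
      have e : ∀ k : Fin n, g k = rowNat a k := fun k => ih k k.isLt
      simp only [e]
      abel

/-- `h_{k;a}` for `k ∈ ℤ`, equal to `0` for `k < 0`. -/
def row (a : ℤ → ℂ) : ℤ → SymFun
  | Int.ofNat k => rowNat a k
  | Int.negSucc _ => 0

/-- The shift `(τ^r a)_i = a_{i+r}`. -/
def shift (r : ℤ) (a : ℤ → ℂ) : ℤ → ℂ := fun i => a (i + r)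

/-- The dual sequence `â_i = -a_{-i+1}`. -/
def dual (a : ℤ → ℂ) : ℤ → ℂ := fun i => -a (-i + 1)

/-- The multiparameter Schur function `s_{μ;a} = det [h_{μ_i - i + j; τ^{1-j} a}]`, of order the
number of rows of `μ`. Here the rows and columns are numbered from `0`, so that the shift
`τ^{1-j}` becomes `τ^{-j}`. -/
def schur (a : ℤ → ℂ) (μ : YoungDiagram) : SymFun :=
  (Matrix.of fun i j : Fin (μ.colLen 0) =>
    row (shift (-(j : ℤ)) a) ((μ.rowLen i : ℤ) - (i : ℤ) + (j : ℤ))).det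

/-- The depth `d(μ)`: the number of diagonal squares. -/
def depth (μ : YoungDiagram) : ℕ := (μ.cells.filter fun c => c.1 = c.2).card

/-- The Frobenius coordinate `p_{i+1} = μ_{i+1} - (i + 1)`, meaningful for `i < d(μ)`. -/
def arm (μ : YoungDiagram) (i : ℕ) : ℕ := μ.rowLen i - (i + 1)

/-- The Frobenius coordinate `q_{i+1} = μ'_{i+1} - (i + 1)`, meaningful for `i < d(μ)`. -/
def leg (μ : YoungDiagram) (i : ℕ) : ℕ := μ.colLen i - (i + 1)

/-- `c_{pp'}(a, b) = h_{p-p'}(b₁, …, b_{p'+1}; -a₁, …, -a_p)`, where `h_k = 0` for `k < 0`. -/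
def hookCoeff (a b : ℤ → ℂ) (p p' : ℕ) : ℂ :=
  if p' ≤ p then
    superEval (fun i : Fin (p' + 1) => b ((i : ℤ) + 1)) (fun i : Fin p => -a ((i : ℤ) + 1))
      (complete (p - p'))
  else 0

/-- `det [c_{p_i, p'_j}(a, b)]` of order `d`. -/
def coeffDet (a b : ℤ → ℂ) (d : ℕ) (p p' : ℕ → ℕ) : ℂ :=
  (Matrix.of fun i j : Fin d => hookCoeff a b (p i) (p' j)).det

/-- `s_{μ;a} = ∑_ν c_ν s_{ν;b}`, a finite sum. -/
def IsExpansion (a b : ℤ → ℂ) (μ : YoungDiagram) (c : YoungDiagram →₀ ℂ) : Prop :=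
  schur a μ = c.sum fun ν z => z • schur b ν

end MultiSchur

end

/-! The sequence `a` enters `s_{μ;a}` only through a choice of bases. There is a fixed bilinear
pairing `hookPairing` on `ℂ[X]`, independent of `a`, whose value at the factorial powers (u|a)^p and
(v|â)^q is the hook function `hook a p q`. The Giambelli formula `schur_eq_det_hook` writes
`s_{μ;a}` as the determinant of these values at the Frobenius coordinates of μ.

The numbers `hookCoeff a b p k` are the coefficients of (u|a)^p in the basis (u|b)^k
(`factorialPower_eq_sum`). Hence the matrix of hooks for `a` is a product A·S·D, with S the matrix
of hooks for `b` and A, D transition matrices. Applying Cauchy–Binet twice gives a sum over pairs of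
strictly decreasing sequences. Such pairs are exactly the Frobenius coordinates of diagrams of depth
`d(μ)`, the minors of S are the `s_{ν;b}`, and the minors of A and D are the two determinants of the
theorem. A and D are unitriangular, which forces ν ⊆ μ.

Giambelli itself comes from factoring the Jacobi–Trudi matrix as Y·K with K unitriangular:
`row_shift_eq_sum` expands its entries with coefficients that do not depend on the column.

Uniqueness is the linear independence of the `s_{ν;b}`. The same expansion, taken from `b` to the
zero sequence, is unitriangular for inclusion and reduces this to ordinary Schur functions, which
are separated by the leading monomials of alternants. -/

noncomputable section

namespace MultiSchur

/-! ### Generating series of the complete functions in a super realization. -/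

section GeneratingFunction

open PowerSeries

variable {R : Type*} [CommRing R]

/-- The equation F' = FP determines (n+1)F_{n+1} from F_0, …, F_n. This stands in for taking
logarithms. -/
theorem eq_of_derivative_eq_mul [IsDomain R] [CharZero R] {F G P : R⟦X⟧}
    (hF : d⁄dX R F = F * P) (hG : d⁄dX R G = G * P) (h0 : constantCoeff F = constantCoeff G) :
    F = G := by
  ext n
  induction n using Nat.strong_induction_on with
  | _ n ih =>
    cases n with
    | zero => simpa using h0
    | succ n =>
      have h1 := coeff_derivative F n
      have h2 := coeff_derivative G n
      rw [hF] at h1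
      rw [hG] at h2
      have h3 : coeff n (F * P) = coeff n (G * P) := by
        simp only [coeff_mul]
        refine Finset.sum_congr rfl fun p hp => ?_
        rw [ih p.1 (by have := Finset.HasAntidiagonal.mem_antidiagonal.mp hp; omega)]
      rw [h1, h2] at h3
      exact mul_right_cancel₀ (by exact_mod_cast n.succ_ne_zero) h3

theorem one_sub_mul_mk_pow (x : R) :
    (1 - C x * X) * PowerSeries.mk (fun k => x ^ (k + 1)) = C x := by
  ext n
  rw [sub_mul, one_mul, mul_assoc, map_sub, coeff_C_mul]
  cases n with
  | zero => simp
  | succ n => simp [coeff_succ_X_mul, pow_succ, mul_comm]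

theorem derivative_prod_one_sub {ι : Type*} (s : Finset ι) (x : ι → R) :
    d⁄dX R (∏ i ∈ s, (1 - C (x i) * X)) =
      -((∏ i ∈ s, (1 - C (x i) * X)) * PowerSeries.mk fun k => ∑ i ∈ s, x i ^ (k + 1)) := by
  classical
  induction s using Finset.induction_on with
  | empty =>
    have : (PowerSeries.mk fun _ : ℕ => (0 : R)) = 0 := by ext; simp
    simp [this]
  | insert i s hi ih =>
    have e : (PowerSeries.mk fun k => ∑ j ∈ insert i s, x j ^ (k + 1)) =
        PowerSeries.mk (fun k => x i ^ (k + 1)) +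
          PowerSeries.mk fun k => ∑ j ∈ s, x j ^ (k + 1) := by
      ext n; simp [Finset.sum_insert hi]
    have d1 : d⁄dX R (1 - C (x i) * X) = -C (x i) := by
      simp [Derivation.leibniz]
    rw [Finset.prod_insert hi, Derivation.leibniz, ih, e, d1]
    simp only [smul_eq_mul]
    linear_combination (-(∏ j ∈ s, (1 - C (x j) * X))) * -(one_sub_mul_mk_pow (x i))

theorem derivative_completeSeries :
    d⁄dX SymFun completeSeries = completeSeries *
      PowerSeries.mk fun k : ℕ => (MvPolynomial.X k.succPNat : SymFun) := by
  have e : d⁄dX SymFun powerSumSeries =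
      PowerSeries.mk fun k : ℕ => (MvPolynomial.X k.succPNat : SymFun) := by
    ext1 n
    rw [coeff_derivative, powerSumSeries, coeff_mk, coeff_mk, dif_pos n.succ_pos, smul_mul_assoc]
    have : ((n : SymFun) + 1) = MvPolynomial.C ((n + 1 : ℕ) : ℂ) := by simp
    rw [this, mul_comm, ← MvPolynomial.smul_eq_C_mul, smul_smul, inv_mul_cancel₀, one_smul]
    · rfl
    · exact_mod_cast n.succ_ne_zero
  rw [completeSeries, derivative_subst hasSubst_powerSumSeries, derivative_exp, e]

theorem constantCoeff_completeSeries : constantCoeff completeSeries = 1 := by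
  have h0 : MvPowerSeries.constantCoeff powerSumSeries = 0 := by
    change PowerSeries.constantCoeff powerSumSeries = 0
    rw [← coeff_zero_eq_constantCoeff_apply, powerSumSeries, coeff_mk]
    simp
  have := constantCoeff_subst hasSubst_powerSumSeries (exp SymFun)
  rw [finsum_eq_single _ 0 (by intro d hd; simp [h0, hd])] at this
  rw [completeSeries]
  refine Eq.trans this ?_
  simp

theorem derivative_map {S : Type*} [CommRing S] (f : R →+* S) (F : R⟦X⟧) :
    d⁄dX S (PowerSeries.map f F) = PowerSeries.map f (d⁄dX R F) := by
  ext n; simp [coeff_derivative]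

/-- The generating series of the `h_k` in a super realization with values in a domain. -/
theorem map_completeSeries_mul [IsDomain R] [Algebra ℂ R] {ι κ : Type*} (s : Finset ι) (t : Finset κ)
    (x : ι → R) (y : κ → R) (φ : SymFun →ₐ[ℂ] R)
    (hφ : ∀ k : ℕ+, φ (MvPolynomial.X k) =
      ∑ i ∈ s, x i ^ (k : ℕ) + (-1) ^ ((k : ℕ) - 1) * ∑ i ∈ t, y i ^ (k : ℕ)) :
    PowerSeries.map (φ : SymFun →+* R) completeSeries * ∏ i ∈ s, (1 - C (x i) * X) =
      ∏ i ∈ t, (1 - C (-y i) * X) := by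
  have : CharZero R := charZero_of_injective_algebraMap (algebraMap ℂ R).injective
  -- `P` is the logarithmic derivative of the right-hand product. On the left, the contribution of
  -- the x_i to H'/H cancels against that of the factors 1 - x_i t.
  refine eq_of_derivative_eq_mul
    (P := -PowerSeries.mk fun k => ∑ i ∈ t, (-y i) ^ (k + 1)) ?_ ?_ ?_
  · rw [Derivation.leibniz, derivative_prod_one_sub, derivative_map, derivative_completeSeries,
      map_mul]
    have e : PowerSeries.map (φ : SymFun →+* R)
        (PowerSeries.mk fun k : ℕ => (MvPolynomial.X k.succPNat : SymFun)) =
        PowerSeries.mk (fun k => ∑ i ∈ s, x i ^ (k + 1)) -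
          PowerSeries.mk fun k => ∑ i ∈ t, (-y i) ^ (k + 1) := by
      ext n
      simp only [coeff_map, coeff_mk, map_sub, RingHom.coe_coe]
      rw [hφ]
      simp only [Nat.succPNat_coe, Nat.succ_eq_add_one, Nat.add_sub_cancel, neg_pow (y _) (n + 1), ← Finset.mul_sum]
      ring
    rw [e]
    simp only [smul_eq_mul]
    ring
  · rw [derivative_prod_one_sub]; ring
  · have e : constantCoeff (PowerSeries.map (φ : SymFun →+* R) completeSeries) = 1 := by
      rw [← coeff_zero_eq_constantCoeff_apply, coeff_map, coeff_zero_eq_constantCoeff_apply,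
        constantCoeff_completeSeries, map_one]
    rw [map_mul, e, map_prod, map_prod]
    simp

end GeneratingFunction

/-! ### Change of basis between factorial powers. -/

section FactorialPower

open PowerSeries

/-- The series `t ^ k (1 - a₁ t) ⋯ (1 - a_p t) / ((1 - b₁ t) ⋯ (1 - b_{k+1} t))`. -/
def transitionSeries (a b : ℤ → ℂ) (p k : ℕ) : ℂ⟦X⟧ :=
  X ^ k * ((∏ i ∈ Finset.range p, (1 - C (a ((i : ℤ) + 1)) * X)) *
    ∏ i ∈ Finset.range (k + 1), (1 - C (b ((i : ℤ) + 1)) * X)⁻¹)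

theorem one_sub_mul_inv (z : ℂ) : (1 - C z * X : ℂ⟦X⟧) * (1 - C z * X)⁻¹ = 1 :=
  PowerSeries.mul_inv_cancel _ (by simp)

theorem hookCoeff_eq_coeff (a b : ℤ → ℂ) (p k : ℕ) :
    hookCoeff a b p k = coeff p (transitionSeries a b p k) := by
  rw [hookCoeff, transitionSeries, coeff_X_pow_mul']
  split_ifs with h
  · have key := map_completeSeries_mul (R := ℂ) Finset.univ Finset.univ
      (fun i : Fin (k + 1) => b ((i : ℤ) + 1)) (fun i : Fin p => -a ((i : ℤ) + 1))
      (superEval (fun i : Fin (k + 1) => b ((i : ℤ) + 1)) (fun i : Fin p => -a ((i : ℤ) + 1)))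
      (fun l => by simp [superEval])
    have e : PowerSeries.map
        ((superEval (fun i : Fin (k + 1) => b ((i : ℤ) + 1))
          (fun i : Fin p => -a ((i : ℤ) + 1)) : SymFun →ₐ[ℂ] ℂ) : SymFun →+* ℂ)
        completeSeries = (∏ i ∈ Finset.range p, (1 - C (a ((i : ℤ) + 1)) * X)) *
          ∏ i ∈ Finset.range (k + 1), (1 - C (b ((i : ℤ) + 1)) * X)⁻¹ := by
      have h1 : (∏ i ∈ Finset.range (k + 1), (1 - C (b ((i : ℤ) + 1)) * X : ℂ⟦X⟧)) *
          ∏ i ∈ Finset.range (k + 1), (1 - C (b ((i : ℤ) + 1)) * X)⁻¹ = 1 := by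
        rw [← Finset.prod_mul_distrib]
        exact Finset.prod_eq_one fun i _ => one_sub_mul_inv _
      simp only [neg_neg] at key
      rw [Fin.prod_univ_eq_prod_range (fun i : ℕ => (1 - C (b ((i : ℤ) + 1)) * X : ℂ⟦X⟧)),
        Fin.prod_univ_eq_prod_range (fun i : ℕ => (1 - C (a ((i : ℤ) + 1)) * X : ℂ⟦X⟧))] at key
      rw [← key, mul_assoc, h1, mul_one]
    rw [← e, coeff_map]
    rfl
  · rfl

theorem transitionSeries_succ_left (a b : ℤ → ℂ) (p k : ℕ) :
    transitionSeries a b (p + 1) k =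
      transitionSeries a b p k * (1 - C (a ((p : ℤ) + 1)) * X) := by
  simp only [transitionSeries, Finset.prod_range_succ _ p]
  ring

theorem transitionSeries_succ_right (a b : ℤ → ℂ) (p k : ℕ) :
    transitionSeries a b p (k + 1) * (1 - C (b ((k : ℤ) + 2)) * X) =
      X * transitionSeries a b p k := by
  have h := one_sub_mul_inv (b ((k : ℤ) + 2))
  simp only [transitionSeries, Finset.prod_range_succ _ (k + 1)]
  have e : (((k + 1 : ℕ) : ℤ) + 1) = (k : ℤ) + 2 := by push_cast; ring
  rw [e]
  linear_combination (X ^ (k + 1) * ((∏ i ∈ Finset.range p, (1 - C (a ((i : ℤ) + 1)) * X)) *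
    ∏ i ∈ Finset.range (k + 1), (1 - C (b ((i : ℤ) + 1)) * X)⁻¹)) * h

/-- The coefficient is always read at t^p, so each factor `X` in the recurrences of
`transitionSeries` lowers p by one. -/
theorem hookCoeff_succ_succ (a b : ℤ → ℂ) (p k : ℕ) :
    hookCoeff a b (p + 1) (k + 1) =
      hookCoeff a b p k + (b ((k : ℤ) + 2) - a ((p : ℤ) + 1)) * hookCoeff a b p (k + 1) := by
  have h : transitionSeries a b (p + 1) (k + 1) =
      X * (transitionSeries a b p k +
        C (b ((k : ℤ) + 2) - a ((p : ℤ) + 1)) * transitionSeries a b p (k + 1)) := by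
    rw [transitionSeries_succ_left, mul_add, ← transitionSeries_succ_right, map_sub]
    ring
  simp only [hookCoeff_eq_coeff]
  rw [h, coeff_succ_X_mul, map_add, coeff_C_mul]

theorem coeff_prod_one_sub_eq_zero {R ι : Type*} [CommRing R] (s : Finset ι) (x : ι → R) {n : ℕ}
    (h : s.card < n) : coeff n (∏ i ∈ s, (1 - C (x i) * X)) = 0 := by
  classical
  induction s using Finset.induction_on generalizing n with
  | empty =>
    rw [Finset.prod_empty, coeff_one, if_neg (by rw [Finset.card_empty] at h; omega)]
  | insert i s hi ih =>
    rw [Finset.card_insert_of_notMem hi] at h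
    obtain ⟨m, rfl⟩ : ∃ m, n = m + 1 := ⟨n - 1, by omega⟩
    rw [Finset.prod_insert hi, sub_mul, one_mul, map_sub, ih (by omega), mul_right_comm,
      mul_comm _ X, coeff_succ_X_mul, coeff_C_mul, ih (by omega)]
    ring

theorem hookCoeff_succ_zero (a b : ℤ → ℂ) (p : ℕ) :
    hookCoeff a b (p + 1) 0 = (b 1 - a ((p : ℤ) + 1)) * hookCoeff a b p 0 := by
  have h0 : transitionSeries a b p 0 * (1 - C (b 1) * X) =
      ∏ i ∈ Finset.range p, (1 - C (a ((i : ℤ) + 1)) * X) := by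
    have h := one_sub_mul_inv (b 1)
    simp only [transitionSeries, zero_add, Finset.prod_range_one, pow_zero, Nat.cast_zero]
    linear_combination (∏ i ∈ Finset.range p, (1 - C (a ((i : ℤ) + 1)) * X)) * h
  have h : transitionSeries a b (p + 1) 0 =
      (∏ i ∈ Finset.range p, (1 - C (a ((i : ℤ) + 1)) * X)) +
      X * (C (b 1 - a ((p : ℤ) + 1)) * transitionSeries a b p 0) := by
    rw [transitionSeries_succ_left, ← h0, map_sub]
    ring
  simp only [hookCoeff_eq_coeff]
  -- The product without denominator has degree at most p, so it contributes nothing at t^(p+1).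
  rw [h, map_add, coeff_prod_one_sub_eq_zero _ (fun i : ℕ => a ((i : ℤ) + 1)) (by simp),
    coeff_succ_X_mul, coeff_C_mul, zero_add]

theorem hookCoeff_of_lt (a b : ℤ → ℂ) {p k : ℕ} (h : p < k) : hookCoeff a b p k = 0 :=
  if_neg (by omega)

theorem hookCoeff_self (a b : ℤ → ℂ) (p : ℕ) : hookCoeff a b p p = 1 := by
  rw [hookCoeff_eq_coeff, transitionSeries, coeff_X_pow_mul', if_pos le_rfl, Nat.sub_self,
    coeff_zero_eq_constantCoeff_apply, map_mul, map_prod, map_prod]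
  simp

/-- The polynomial `(u - a₁) ⋯ (u - a_p)`. -/
def factorialPower (a : ℤ → ℂ) (p : ℕ) : Polynomial ℂ :=
  ∏ i ∈ Finset.range p, (Polynomial.X - Polynomial.C (a ((i : ℤ) + 1)))

theorem factorialPower_succ (a : ℤ → ℂ) (p : ℕ) :
    factorialPower a (p + 1) =
      factorialPower a p * (Polynomial.X - Polynomial.C (a ((p : ℤ) + 1))) :=
  Finset.prod_range_succ _ _

/-- Induction on p with u - a_{p+1} = (u - b_{k+1}) + (b_{k+1} - a_{p+1}): multiplying the k-th term
yields exactly the recurrences for `hookCoeff`. -/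
theorem factorialPower_eq_sum (a b : ℤ → ℂ) (p : ℕ) :
    factorialPower a p =
      ∑ k ∈ Finset.range (p + 1), hookCoeff a b p k • factorialPower b k := by
  induction p with
  | zero => simp [factorialPower, hookCoeff_self]
  | succ p ih =>
    have step : ∀ k : ℕ, (hookCoeff a b p k • factorialPower b k) *
        (Polynomial.X - Polynomial.C (a ((p : ℤ) + 1))) =
        hookCoeff a b p k • factorialPower b (k + 1) +
        ((b ((k : ℤ) + 1) - a ((p : ℤ) + 1)) * hookCoeff a b p k) • factorialPower b k := by
      intro k
      simp only [factorialPower_succ, Polynomial.smul_eq_C_mul, map_mul, map_sub]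
      ring
    rw [factorialPower_succ, ih, Finset.sum_mul, Finset.sum_congr rfl fun k _ => step k,
      Finset.sum_add_distrib, Finset.sum_range_succ' (n := p + 1), hookCoeff_succ_zero]
    have e : ∑ k ∈ Finset.range (p + 1),
        ((b ((k : ℤ) + 1) - a ((p : ℤ) + 1)) * hookCoeff a b p k) • factorialPower b k =
        ∑ k ∈ Finset.range (p + 1 + 1),
        ((b ((k : ℤ) + 1) - a ((p : ℤ) + 1)) * hookCoeff a b p k) • factorialPower b k := by
      rw [Finset.sum_range_succ _ (p + 1), hookCoeff_of_lt a b p.lt_succ_self]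
      simp
    rw [e, Finset.sum_range_succ' (n := p + 1), ← add_assoc, ← Finset.sum_add_distrib]
    congr 1
    refine Finset.sum_congr rfl fun k _ => ?_
    rw [hookCoeff_succ_succ, add_smul]
    push_cast
    ring_nf

end FactorialPower

/-! ### Residue functional, hook pairing, and expansion of Jacobi–Trudi entries. -/

section Functional

open Polynomial

/-- The linear functional `u ^ k ↦ h_{k+1}`, that is, `f ↦ Res f(u) H(u⁻¹) du`. -/
def residue : ℂ[X] →ₗ[ℂ] SymFun :=
  (Polynomial.basisMonomials ℂ).constr ℂ fun k => complete (k + 1)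

@[simp] theorem residue_X_pow (k : ℕ) : residue (X ^ k) = complete (k + 1) := by
  rw [residue, show (X ^ k : ℂ[X]) = Polynomial.basisMonomials ℂ k by
    simp [Polynomial.monomial_one_right_eq_X_pow], Module.Basis.constr_basis]

theorem complete_zero : complete 0 = 1 := by
  rw [complete, PowerSeries.coeff_zero_eq_constantCoeff_apply, constantCoeff_completeSeries]

theorem rowNat_zero (a : ℤ → ℂ) : rowNat a 0 = 1 := by
  rw [rowNat]; simp [complete_zero]

theorem factorialPower_zero_left (p : ℕ) : factorialPower 0 p = X ^ p := by
  simp [factorialPower]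

theorem coeff_invFactorialPower_succ (a : ℤ → ℂ) (n k : ℕ) :
    PowerSeries.coeff (n + 1) (invFactorialPower a (k + 1)) = hookCoeff 0 a n k := by
  rw [hookCoeff_eq_coeff, ← PowerSeries.coeff_succ_X_mul n, invFactorialPower, transitionSeries]
  congr 1
  simp only [Pi.zero_apply, map_zero, zero_mul, sub_zero, Finset.prod_const_one, one_mul]
  ring

/-- The coefficients of 1/(u|a)^(k+1) at u^(-n-1) are also those of u^n in the basis (u|a)^k.
Applying `residue` to that expansion of u^n therefore gives the defining relations of `h_{k;a}`. -/
theorem rowNat_succ (a : ℤ → ℂ) (n : ℕ) : rowNat a (n + 1) = residue (factorialPower a n) := by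
  let g : ℕ → SymFun := fun n => Nat.casesOn n 1 fun n => residue (factorialPower a n)
  have hg : g = rowNat a := by
    rw [eq_rowNat_iff]
    intro n
    cases n with
    | zero => simp [g, invFactorialPower, complete_zero]
    | succ n =>
      rw [Finset.sum_range_succ']
      have e : PowerSeries.coeff (n + 1) (invFactorialPower a 0) = 0 := by
        simp [invFactorialPower, PowerSeries.coeff_one]
      simp only [e, coeff_invFactorialPower_succ, zero_smul, add_zero]
      rw [← residue_X_pow, ← factorialPower_zero_left, factorialPower_eq_sum 0 a, map_sum]
      simp [g]
  rw [← hg]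

/-- The coefficient `e` of the inverse of the generating series of the `h_k`. -/
def inverseCoeff (k : ℕ) : SymFun := PowerSeries.coeff k (PowerSeries.invOfUnit completeSeries 1)

theorem sum_inverseCoeff_mul_complete (j : ℕ) :
    ∑ k ∈ Finset.range (j + 1), inverseCoeff (j - k) * complete (k + 1) =
      -inverseCoeff (j + 1) := by
  have h := PowerSeries.mul_invOfUnit completeSeries 1 (by simp [constantCoeff_completeSeries])
  have h2 := congrArg (PowerSeries.coeff (j + 1)) h
  rw [PowerSeries.coeff_mul, Finset.Nat.sum_antidiagonal_eq_sum_range_succ_mk,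
    Finset.sum_range_succ', PowerSeries.coeff_one, if_neg j.succ_ne_zero] at h2
  change ∑ k ∈ Finset.range (j + 1), complete (k + 1) * inverseCoeff (j + 1 - (k + 1)) +
    complete 0 * inverseCoeff (j + 1) = 0 at h2
  rw [complete_zero, one_mul] at h2
  rw [← add_eq_zero_iff_eq_neg, ← h2]
  congr 1
  refine Finset.sum_congr rfl fun k _ => ?_
  rw [mul_comm, Nat.add_sub_add_right]

theorem inverseCoeff_zero : inverseCoeff 0 = 1 := by
  rw [inverseCoeff, PowerSeries.coeff_zero_eq_constantCoeff_apply,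
    PowerSeries.constantCoeff_invOfUnit]
  simp

/-- The bilinear pairing of polynomials that takes `(u ^ i, (-v) ^ j)` to the hook Schur function
`s_{(i|j)}`. -/
def residuePairing : ℂ[X] →ₗ[ℂ] ℂ[X] →ₗ[ℂ] SymFun :=
  (Polynomial.basisMonomials ℂ).constr ℂ fun i =>
    (Polynomial.basisMonomials ℂ).constr ℂ fun j =>
      ∑ k ∈ Finset.range (j + 1), inverseCoeff (j - k) * complete (i + k + 1)

theorem residuePairing_X_pow (i j : ℕ) : residuePairing (X ^ i) (X ^ j) =
    ∑ k ∈ Finset.range (j + 1), inverseCoeff (j - k) * complete (i + k + 1) := by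
  have e : ∀ k : ℕ, (X ^ k : ℂ[X]) = Polynomial.basisMonomials ℂ k := fun k => by
    simp [Polynomial.monomial_one_right_eq_X_pow]
  rw [residuePairing, e, e, Module.Basis.constr_basis, Module.Basis.constr_basis]

theorem linearMap_ext_X_pow {M : Type*} [AddCommMonoid M] [Module ℂ M] {f g : ℂ[X] →ₗ[ℂ] M}
    (h : ∀ n : ℕ, f (X ^ n) = g (X ^ n)) : f = g := by
  refine (Polynomial.basisMonomials ℂ).ext fun n => ?_
  simpa [Polynomial.monomial_one_right_eq_X_pow] using h n

theorem residuePairing_one_right (f : ℂ[X]) : residuePairing f 1 = residue f := by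
  have : residuePairing.flip 1 = residue := by
    refine linearMap_ext_X_pow fun n => ?_
    rw [LinearMap.flip_apply, ← pow_zero X, residuePairing_X_pow]
    simp [inverseCoeff_zero]
  exact LinearMap.congr_fun this f

/-- On monomials the two sums agree after an index shift, except for the k = 0 term. That term is a
product because `residuePairing 1 (X ^ j)` is `-inverseCoeff (j + 1)`. -/
theorem residuePairing_X_mul (f g : ℂ[X]) :
    residuePairing (X * f) g = residuePairing f (X * g) + residue f * residuePairing 1 g := by
  let A : ℂ[X] →ₗ[ℂ] ℂ[X] →ₗ[ℂ] SymFun := residuePairing ∘ₗ LinearMap.mulLeft ℂ X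
  let B : ℂ[X] →ₗ[ℂ] ℂ[X] →ₗ[ℂ] SymFun :=
    residuePairing.compl₂ (LinearMap.mulLeft ℂ X) +
      (LinearMap.mul ℂ SymFun).compl₁₂ residue (residuePairing 1)
  have : A = B := by
    refine linearMap_ext_X_pow fun i => linearMap_ext_X_pow fun j => ?_
    simp only [A, B, LinearMap.comp_apply, LinearMap.mulLeft_apply, LinearMap.add_apply,
      LinearMap.compl₂_apply, LinearMap.compl₁₂_apply, LinearMap.mul_apply', residue_X_pow]
    rw [← pow_succ', ← pow_succ', ← pow_zero X, residuePairing_X_pow, residuePairing_X_pow,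
      residuePairing_X_pow, Finset.sum_range_succ' (n := j + 1)]
    simp only [zero_add, sum_inverseCoeff_mul_complete, Nat.add_sub_add_right]
    have : ∀ k, i + 1 + k + 1 = i + (k + 1) + 1 := fun k => by ring
    simp only [this, Nat.sub_zero, add_zero]
    ring
  exact LinearMap.congr_fun₂ this f g

/-- The linear factors move one at a time from the first argument of the pairing to the second. By
the case f = 1, the correction terms of one move add up to `residue f * rowNat c (n + 1)`, the new
top term. -/
theorem residue_mul_factorialPower (c : ℤ → ℂ) (f : ℂ[X]) (n : ℕ) :
    residue (f * factorialPower c n) = ∑ m ∈ Finset.range (n + 1),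
      rowNat c m * residuePairing f (∏ i ∈ Finset.Ico m n, (X - C (c ((i : ℤ) + 1)))) := by
  induction n generalizing f with
  | zero => simp [factorialPower, rowNat_zero, residuePairing_one_right]
  | succ n ih =>
    have hmul : ∀ g, residuePairing ((X - C (c ((n : ℤ) + 1))) * f) g =
        residuePairing f (g * (X - C (c ((n : ℤ) + 1)))) + residue f * residuePairing 1 g := by
      intro g
      rw [sub_mul, ← Polynomial.smul_eq_C_mul, map_sub, map_smul, LinearMap.sub_apply,
        LinearMap.smul_apply, residuePairing_X_mul, mul_sub, mul_comm g, mul_comm g,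
        ← Polynomial.smul_eq_C_mul, map_sub, map_smul]
      ring
    have h1 := ih 1
    rw [one_mul, ← rowNat_succ] at h1
    rw [factorialPower_succ, show f * (factorialPower c n * (X - C (c ((n : ℤ) + 1)))) =
      ((X - C (c ((n : ℤ) + 1))) * f) * factorialPower c n by ring, ih,
      Finset.sum_range_succ _ (n + 1), h1]
    simp only [hmul, mul_add, Finset.sum_add_distrib, Finset.Ico_self, Finset.prod_empty,
      residuePairing_one_right]
    congr 1
    · refine Finset.sum_congr rfl fun m hm => ?_
      rw [Finset.prod_Ico_succ_top (by have := Finset.mem_range.mp hm; omega)]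
    · rw [Finset.sum_mul]
      exact Finset.sum_congr rfl fun m _ => by ring

/-- The pairing `(u ^ i, v ^ j) ↦ s_{(i|j)}`. -/
def hookPairing : ℂ[X] →ₗ[ℂ] ℂ[X] →ₗ[ℂ] SymFun :=
  residuePairing.compl₂ (Polynomial.aeval (-X : ℂ[X])).toLinearMap

/-- The multiparameter Schur function of the hook `(p|q)`. -/
def hook (a : ℤ → ℂ) (p q : ℕ) : SymFun :=
  hookPairing (factorialPower a p) (factorialPower (dual a) q)

/-- The pairing is bilinear and does not involve the sequence, so only the two bases change. -/
theorem hook_eq_sum (a b : ℤ → ℂ) (p q : ℕ) :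
    hook a p q = ∑ k ∈ Finset.range (p + 1), ∑ l ∈ Finset.range (q + 1),
      (hookCoeff a b p k * hookCoeff (dual a) (dual b) q l) • hook b k l := by
  rw [hook, factorialPower_eq_sum a b, factorialPower_eq_sum (dual a) (dual b),
    map_sum hookPairing, LinearMap.sum_apply]
  refine Finset.sum_congr rfl fun k _ => ?_
  rw [map_sum]
  refine Finset.sum_congr rfl fun l _ => ?_
  rw [map_smul, map_smul, LinearMap.smul_apply, smul_smul, mul_comm]
  rfl

theorem hook_eq_residuePairing (a : ℤ → ℂ) (p q : ℕ) :
    (-1) ^ q * hook a p q = residuePairing (factorialPower a p)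
      (∏ s ∈ Finset.range q, (X - C (a (-(s : ℤ))))) := by
  -- Since â_{s+1} = -a_{-s}, the factor v - â_{s+1} becomes -(u - a_{-s}) at v = -u.
  have e : (Polynomial.aeval (-X : ℂ[X])) (factorialPower (dual a) q) =
      ((-1 : ℂ) ^ q) • ∏ s ∈ Finset.range q, (X - C (a (-(s : ℤ)))) := by
    rw [factorialPower, map_prod, Polynomial.smul_eq_C_mul, map_pow, map_neg, map_one]
    conv_rhs => rw [← Finset.card_range q, ← Finset.prod_const, Finset.card_range q,
      ← Finset.prod_mul_distrib]
    refine Finset.prod_congr rfl fun s _ => ?_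
    simp [dual]
    ring
  rw [hook, hookPairing, LinearMap.compl₂_apply, AlgHom.toLinearMap_apply, e, map_smul,
    MvPolynomial.smul_eq_C_mul, ← mul_assoc]
  simp [← mul_pow]

/-- The sequence τ^{-j}a starts with a_{1-j}, …, a_0 and continues with a_1, a_2, …, so (u|a)^p
splits off as a factor. The coefficients `(-1) ^ k * hook a p k` are independent of j, which makes
the Jacobi–Trudi matrix factor. -/
theorem row_shift_eq_sum (a : ℤ → ℂ) (p j : ℕ) :
    row (shift (-(j : ℤ)) a) ((p : ℤ) + 1 + j) = ∑ k ∈ Finset.range (j + 1),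
      ((-1) ^ k * hook a p k) * row (shift (-(j : ℤ)) a) ((j : ℤ) - k) := by
  have e1 : row (shift (-(j : ℤ)) a) ((p : ℤ) + 1 + j) =
      residue (factorialPower (shift (-(j : ℤ)) a) (j + p)) := by
    rw [← rowNat_succ, show (p : ℤ) + 1 + j = ((j + p + 1 : ℕ) : ℤ) by push_cast; ring]
    rfl
  have e2 : factorialPower (shift (-(j : ℤ)) a) (j + p) =
      factorialPower a p * factorialPower (shift (-(j : ℤ)) a) j := by
    rw [factorialPower, Finset.prod_range_add, mul_comm]
    congr 1
    refine Finset.prod_congr rfl fun i _ => ?_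
    rw [shift]
    congr 3
    push_cast
    ring
  rw [e1, e2, residue_mul_factorialPower, ← Finset.sum_range_reflect]
  refine Finset.sum_congr rfl fun k hk => ?_
  have hk' : k ≤ j := by have := Finset.mem_range.mp hk; omega
  rw [hook_eq_residuePairing, mul_comm]
  congr 1
  · congr 1
    -- The k linear factors left over have roots a_{1-k}, …, a_0; reversing their order matches the
    -- product for `hook a p k`.
    rw [Finset.prod_Ico_eq_prod_range, ← Finset.prod_range_reflect]
    have : j - (j + 1 - 1 - k) = k := by omega
    rw [this]
    refine Finset.prod_congr rfl fun s hs => ?_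
    have := Finset.mem_range.mp hs
    rw [shift]
    congr 3
    omega
  · rw [show (j : ℤ) - k = ((j + 1 - 1 - k : ℕ) : ℤ) by omega]
    rfl

end Functional

/-! ### Frobenius coordinates of Young diagrams. -/

section Frobenius

theorem diag_mem_iff (μ : YoungDiagram) (i : ℕ) : (i, i) ∈ μ ↔ i < depth μ := by
  classical
  have hex : ∃ i, (i, i) ∉ μ := by
    obtain ⟨j, hj⟩ := μ.exists_notMem_row 0
    exact ⟨j, fun h => hj (μ.up_left_mem (Nat.zero_le _) le_rfl h)⟩
  have key : ∀ i, (i, i) ∈ μ ↔ i < Nat.find hex := by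
    intro i
    constructor
    · intro h
      by_contra hlt
      exact Nat.find_spec hex (μ.up_left_mem (not_lt.mp hlt) (not_lt.mp hlt) h)
    · intro h
      exact not_not.mp (Nat.find_min hex h)
  have hdepth : depth μ = Nat.find hex := by
    have : μ.cells.filter (fun c => c.1 = c.2) =
        (Finset.range (Nat.find hex)).image fun i => (i, i) := by
      ext ⟨i, j⟩
      simp only [Finset.mem_filter, Finset.mem_image, Finset.mem_range, Prod.mk.injEq,
        YoungDiagram.mem_cells]
      constructor
      · rintro ⟨h, rfl⟩
        exact ⟨i, (key i).mp h, rfl, rfl⟩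
      · rintro ⟨k, h, rfl, rfl⟩
        exact ⟨(key k).mpr h, rfl⟩
    rw [depth, this, Finset.card_image_of_injective _ fun i j h => (Prod.mk.inj h).1,
      Finset.card_range]
  rw [hdepth]
  exact key i

theorem rowLen_eq_arm (μ : YoungDiagram) {i : ℕ} (hi : i < depth μ) :
    μ.rowLen i = i + 1 + arm μ i := by
  have := YoungDiagram.mem_iff_lt_rowLen.mp ((diag_mem_iff μ i).mpr hi)
  rw [arm]
  omega

theorem colLen_eq_leg (μ : YoungDiagram) {i : ℕ} (hi : i < depth μ) :
    μ.colLen i = i + 1 + leg μ i := by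
  have := YoungDiagram.mem_iff_lt_colLen.mp ((diag_mem_iff μ i).mpr hi)
  rw [leg]
  omega

theorem rowLen_le_of_depth_le (μ : YoungDiagram) {i : ℕ} (hi : depth μ ≤ i) :
    μ.rowLen i ≤ i := by
  have := mt (diag_mem_iff μ i).mp (not_lt.mpr hi)
  rw [YoungDiagram.mem_iff_lt_rowLen] at this
  omega

theorem arm_lt_arm (μ : YoungDiagram) {i j : ℕ} (hij : i < j) (hj : j < depth μ) :
    arm μ j < arm μ i := by
  have h1 := rowLen_eq_arm μ hj
  have h2 := rowLen_eq_arm μ (hij.trans hj)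
  have := μ.rowLen_anti i j hij.le
  omega

theorem leg_lt_leg (μ : YoungDiagram) {i j : ℕ} (hij : i < j) (hj : j < depth μ) :
    leg μ j < leg μ i := by
  have h1 := colLen_eq_leg μ hj
  have h2 := colLen_eq_leg μ (hij.trans hj)
  have := μ.colLen_anti i j hij.le
  omega

theorem mem_iff_frobenius (μ : YoungDiagram) (i j : ℕ) :
    (i, j) ∈ μ ↔ (i ≤ j ∧ i < depth μ ∧ j ≤ i + arm μ i) ∨
      (j < i ∧ j < depth μ ∧ i ≤ j + leg μ j) := by
  by_cases hij : i ≤ j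
  · by_cases hi : i < depth μ
    · have := rowLen_eq_arm μ hi
      rw [YoungDiagram.mem_iff_lt_rowLen]
      omega
    · have : (i, j) ∉ μ := fun h =>
        hi ((diag_mem_iff μ i).mp (μ.up_left_mem le_rfl hij h))
      simp only [this, false_iff]
      omega
  · by_cases hj : j < depth μ
    · have := colLen_eq_leg μ hj
      rw [YoungDiagram.mem_iff_lt_colLen]
      omega
    · have : (i, j) ∉ μ := fun h =>
        hj ((diag_mem_iff μ j).mp (μ.up_left_mem (by omega) le_rfl h))
      simp only [this, false_iff]
      omega

theorem le_of_arm_le_of_leg_le {ν μ : YoungDiagram} (hd : depth ν = depth μ)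
    (ha : ∀ i < depth μ, arm ν i ≤ arm μ i) (hl : ∀ i < depth μ, leg ν i ≤ leg μ i) : ν ≤ μ := by
  rintro ⟨i, j⟩ h
  change (i, j) ∈ ν at h
  rw [mem_iff_frobenius, hd] at h
  rw [mem_iff_frobenius]
  rcases h with ⟨h1, h2, h3⟩ | ⟨h1, h2, h3⟩
  · exact Or.inl ⟨h1, h2, h3.trans (Nat.add_le_add_left (ha i h2) i)⟩
  · exact Or.inr ⟨h1, h2, h3.trans (Nat.add_le_add_left (hl j h2) j)⟩

/-- Strictly decreasing integers drop by at least one at each step. In `exists_frobenius` this is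
what makes the set of boxes a lower set. -/
theorem add_le_add_of_strictAnti {d : ℕ} {p : Fin d → ℕ} (hp : StrictAnti p) {k l : Fin d}
    (h : k ≤ l) : (l : ℕ) + p l ≤ k + p k := by
  obtain ⟨l, hl⟩ := l
  induction l with
  | zero =>
    have : k = ⟨0, hl⟩ := le_antisymm h (Fin.mk_le_of_le_val (Nat.zero_le _))
    rw [this]
  | succ l ih =>
    rcases h.eq_or_lt with rfl | h
    · exact le_rfl
    · have h1 := ih (by omega) (Fin.le_def.mpr (Nat.le_of_lt_succ (Fin.lt_def.mp h)))
      have h2 := hp (show (⟨l, by omega⟩ : Fin d) < ⟨l + 1, hl⟩ from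
        Fin.lt_def.mpr (Nat.lt_succ_self l))
      simp only at h1 ⊢
      omega

theorem exists_frobenius {d : ℕ} {p q : Fin d → ℕ} (hp : StrictAnti p) (hq : StrictAnti q) :
    ∃ ν : YoungDiagram, depth ν = d ∧ ∀ i : Fin d, arm ν i = p i ∧ leg ν i = q i := by
  classical
  -- The description of boxes in `mem_iff_frobenius`: the k-th arm, including the diagonal box, or
  -- the k-th leg.
  let P : ℕ × ℕ → Prop := fun c => ∃ k : Fin d,
    ((k : ℕ) = c.1 ∧ c.1 ≤ c.2 ∧ c.2 ≤ k + p k) ∨ ((k : ℕ) = c.2 ∧ c.2 < c.1 ∧ c.1 ≤ k + q k)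
  have hbound : ∀ c, P c →
      c ∈ Finset.range (d + ∑ k, p k + ∑ k, q k) ×ˢ Finset.range (d + ∑ k, p k + ∑ k, q k) := by
    rintro ⟨i, j⟩ ⟨k, hk⟩
    have h1 := Finset.single_le_sum (f := p) (fun _ _ => Nat.zero_le _) (Finset.mem_univ k)
    have h2 := Finset.single_le_sum (f := q) (fun _ _ => Nat.zero_le _) (Finset.mem_univ k)
    have h3 := k.isLt
    simp only [Finset.mem_product, Finset.mem_range]
    simp only at hk
    omega
  have hlower : ∀ c c', c' ≤ c → P c → P c' := by
    rintro ⟨i, j⟩ ⟨i', j'⟩ hle ⟨k, hk⟩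
    obtain ⟨hi, hj⟩ := Prod.mk_le_mk.mp hle
    have hkd := k.isLt
    simp only at hk
    by_cases h : i' ≤ j'
    · have h1 := add_le_add_of_strictAnti hp (k := ⟨i', by omega⟩) (l := k)
        (Fin.le_def.mpr (by simp only; omega))
      exact ⟨⟨i', by omega⟩, Or.inl ⟨rfl, h, by simp only at h1 ⊢; omega⟩⟩
    · have h1 := add_le_add_of_strictAnti hq (k := ⟨j', by omega⟩) (l := k)
        (Fin.le_def.mpr (by simp only; omega))
      exact ⟨⟨j', by omega⟩, Or.inr ⟨rfl, not_le.mp h, by simp only at h1 ⊢; omega⟩⟩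
  let ν : YoungDiagram :=
    { cells := (Finset.range (d + ∑ k, p k + ∑ k, q k) ×ˢ
        Finset.range (d + ∑ k, p k + ∑ k, q k)).filter P
      isLowerSet := by
        intro c c' hle hc
        have hP := hlower c c' hle (Finset.mem_filter.mp (Finset.mem_coe.mp hc)).2
        exact Finset.mem_coe.mpr (Finset.mem_filter.mpr ⟨hbound _ hP, hP⟩) }
  have hmem : ∀ c, c ∈ ν ↔ P c := fun c =>
    ⟨fun h => (Finset.mem_filter.mp h).2, fun h => Finset.mem_filter.mpr ⟨hbound _ h, h⟩⟩
  have hdepth : depth ν = d := by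
    refine eq_of_forall_lt_iff fun i => ?_
    rw [← diag_mem_iff, hmem]
    constructor
    · rintro ⟨k, hk⟩
      have := k.isLt
      simp only at hk
      omega
    · exact fun h => ⟨⟨i, h⟩, Or.inl ⟨rfl, le_rfl, Nat.le_add_right _ _⟩⟩
  refine ⟨ν, hdepth, fun i => ⟨?_, ?_⟩⟩
  · have h : ν.rowLen i = i + 1 + p i := by
      refine eq_of_forall_lt_iff fun j => ?_
      rw [← YoungDiagram.mem_iff_lt_rowLen, hmem]
      constructor
      · rintro ⟨k, hk⟩
        simp only at hk
        rcases hk with ⟨h1, h2, h3⟩ | hk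
        · rw [Fin.ext h1] at h3
          omega
        · omega
      · intro hj
        by_cases hij : (i : ℕ) ≤ j
        · exact ⟨i, Or.inl ⟨rfl, hij, by simp only; omega⟩⟩
        · have hi := i.isLt
          have := add_le_add_of_strictAnti hq (k := ⟨j, by omega⟩) (l := i)
            (Fin.le_def.mpr (by simp only; omega))
          exact ⟨⟨j, by omega⟩, Or.inr ⟨rfl, not_le.mp hij, by simp only at this ⊢; omega⟩⟩
    rw [arm, h]
    omega
  · have h : ν.colLen i = i + 1 + q i := by
      refine eq_of_forall_lt_iff fun j => ?_
      rw [← YoungDiagram.mem_iff_lt_colLen, hmem]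
      constructor
      · rintro ⟨k, hk⟩
        simp only at hk
        rcases hk with hk | ⟨h1, h2, h3⟩
        · omega
        · rw [Fin.ext h1] at h3
          omega
      · intro hj
        by_cases hij : (i : ℕ) < j
        · exact ⟨i, Or.inr ⟨rfl, hij, by simp only; omega⟩⟩
        · have hi := i.isLt
          have := add_le_add_of_strictAnti hp (k := ⟨j, by omega⟩) (l := i)
            (Fin.le_def.mpr (by simp only; omega))
          exact ⟨⟨j, by omega⟩, Or.inl ⟨rfl, not_lt.mp hij, by simp only at this ⊢; omega⟩⟩
    rw [leg, h]
    omega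

end Frobenius

/-! ### The Giambelli formula. -/

section Giambelli

variable {R : Type*} [CommRing R]

/-- For i < d, entries before position i have larger values, so each of the π(i) values below π(i)
occurs later and is an inversion. The last n positions have no inversions among themselves. -/
theorem sign_of_strictAnti_strictMono {d n : ℕ} (π : Equiv.Perm (Fin (d + n)))
    (h1 : ∀ i j : Fin (d + n), i < j → (j : ℕ) < d → π j < π i)
    (h2 : ∀ i j : Fin (d + n), i < j → d ≤ (i : ℕ) → π i < π j) :
    (Equiv.Perm.sign π : ℤˣ) = ∏ i : Fin d, (-1) ^ (π (Fin.castAdd n i) : ℕ) := by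
  rw [Equiv.Perm.sign_eq_prod_prod_Ioi, Fin.prod_univ_add]
  have hr : ∏ i : Fin n, ∏ j ∈ Finset.Ioi (Fin.natAdd d i),
      (if π (Fin.natAdd d i) < π j then (1 : ℤˣ) else -1) = 1 := by
    refine Finset.prod_eq_one fun i _ => Finset.prod_eq_one fun j hj => ?_
    rw [if_pos (h2 _ _ (Finset.mem_Ioi.mp hj) (by simp))]
  rw [hr, mul_one]
  refine Finset.prod_congr rfl fun i _ => ?_
  rw [Finset.prod_ite, Finset.prod_const_one, one_mul, Finset.prod_const]
  congr 1
  rw [← Fin.card_Iio (π (Fin.castAdd n i)), ← Finset.card_image_of_injective _ π.injective]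
  congr 1
  ext v
  simp only [Finset.mem_image, Finset.mem_filter, Finset.mem_Ioi, Finset.mem_Iio]
  constructor
  · rintro ⟨j, ⟨hj, hlt⟩, rfl⟩
    exact lt_of_le_of_ne (not_lt.mp hlt) fun h => hj.ne' (π.injective h)
  · intro hv
    refine ⟨π.symm v, ⟨?_, by simpa using hv.le⟩, by simp⟩
    by_contra hlt
    rcases (not_lt.mp hlt).eq_or_lt with h | h
    · rw [← h] at hv
      simp at hv
    · have := h1 _ _ h (by simp)
      rw [Equiv.apply_symm_apply] at this
      exact lt_asymm this hv

theorem det_eq_mul_of_lower_left_zero {d n : ℕ} (A : Matrix (Fin (d + n)) (Fin (d + n)) R)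
    (h : ∀ (i : Fin n) (j : Fin d), A (Fin.natAdd d i) (Fin.castAdd n j) = 0) :
    A.det = (A.submatrix (Fin.castAdd n) (Fin.castAdd n)).det *
      (A.submatrix (Fin.natAdd d) (Fin.natAdd d)).det := by
  rw [← Matrix.det_submatrix_equiv_self finSumFinEquiv A,
    ← Matrix.fromBlocks_toBlocks (A.submatrix finSumFinEquiv finSumFinEquiv)]
  have h0 : (A.submatrix finSumFinEquiv finSumFinEquiv).toBlocks₂₁ = 0 := by
    ext i j
    simpa [Matrix.toBlocks₂₁] using h i j
  rw [h0, Matrix.det_fromBlocks_zero₂₁]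
  congr 1

theorem det_eq_of_unit_rows {d n : ℕ} (Y : Matrix (Fin (d + n)) (Fin (d + n)) R)
    (π : Equiv.Perm (Fin (d + n)))
    (h1 : ∀ i j : Fin (d + n), i < j → (j : ℕ) < d → π j < π i)
    (h2 : ∀ i j : Fin (d + n), i < j → d ≤ (i : ℕ) → π i < π j)
    (hY : ∀ (i : Fin n) k, Y (Fin.natAdd d i) k = if k = π (Fin.natAdd d i) then 1 else 0) :
    Y.det = (∏ i : Fin d, (-1) ^ (π (Fin.castAdd n i) : ℕ)) *
      (Matrix.of fun i j : Fin d => Y (Fin.castAdd n i) (π (Fin.castAdd n j))).det := by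
  have e1 := Matrix.det_permute' π Y
  have e2 : (Y.submatrix id π).det =
      (Matrix.of fun i j : Fin d => Y (Fin.castAdd n i) (π (Fin.castAdd n j))).det := by
    rw [det_eq_mul_of_lower_left_zero]
    · have : ((Y.submatrix id π).submatrix (Fin.natAdd d) (Fin.natAdd d)) =
          (1 : Matrix (Fin n) (Fin n) R) := by
        ext i j
        simp only [Matrix.submatrix_apply, id, hY, Matrix.one_apply, π.injective.eq_iff]
        refine if_congr ?_ rfl rfl
        rw [Fin.natAdd_inj, eq_comm]
      rw [this, Matrix.det_one, mul_one]
      rfl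
    · intro i j
      simp only [Matrix.submatrix_apply, id, hY, π.injective.eq_iff]
      exact if_neg fun h => by
        have := congrArg Fin.val h
        simp only [Fin.val_castAdd, Fin.val_natAdd] at this
        omega
  have hs := sign_of_strictAnti_strictMono π h1 h2
  have hs' : ((Equiv.Perm.sign π : ℤ) : R) =
      ∏ i : Fin d, (-1) ^ (π (Fin.castAdd n i) : ℕ) := by
    rw [hs]; push_cast; rfl
  rw [e2, hs'] at e1
  rw [e1, ← mul_assoc, ← Finset.prod_mul_distrib]
  simp [← mul_pow]

theorem row_of_neg (a : ℤ → ℂ) {k : ℤ} (h : k < 0) : row a k = 0 := by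
  cases k with
  | ofNat k => exact absurd h (by simp)
  | negSucc k => rfl

theorem row_zero (a : ℤ → ℂ) : row a 0 = 1 := rowNat_zero a

/-- The Jacobi–Trudi matrix of the empty diagram, of any order, is unitriangular. -/
theorem det_row_shift (a : ℤ → ℂ) (N : ℕ) :
    (Matrix.of fun k j : Fin N => row (shift (-(j : ℤ)) a) ((j : ℤ) - k)).det = 1 := by
  rw [Matrix.det_of_isUpperTriangular]
  · simp [row_zero]
  · intro i j h
    have : (j : ℕ) < i := h
    exact row_of_neg _ (by omega)

theorem depth_le_colLen (μ : YoungDiagram) : depth μ ≤ μ.colLen 0 := by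
  by_contra h
  have h1 : (μ.colLen 0, 0) ∈ μ :=
    μ.up_left_mem le_rfl (Nat.zero_le _) ((diag_mem_iff μ _).mpr (not_le.mp h))
  exact lt_irrefl _ (YoungDiagram.mem_iff_lt_colLen.mp h1)

theorem leg_lt_colLen (μ : YoungDiagram) {i : ℕ} (hi : i < depth μ) : leg μ i < μ.colLen 0 := by
  have := colLen_eq_leg μ hi
  have := μ.colLen_anti 0 i (Nat.zero_le _)
  omega

/-- The left side is smaller than the leg if (i, j) lies in μ and larger otherwise. -/
theorem sub_rowLen_ne_leg (μ : YoungDiagram) {i j : ℕ} (hi : depth μ ≤ i) (hj : j < depth μ) :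
    i - μ.rowLen i ≠ leg μ j := by
  have h1 := rowLen_le_of_depth_le μ hi
  have h2 := colLen_eq_leg μ hj
  by_cases h : (i, j) ∈ μ
  · have h3 := YoungDiagram.mem_iff_lt_rowLen.mp h
    have h4 := YoungDiagram.mem_iff_lt_colLen.mp h
    omega
  · have h3 := mt YoungDiagram.mem_iff_lt_rowLen.mpr h
    have h4 := mt YoungDiagram.mem_iff_lt_colLen.mpr h
    omega

/-- The Giambelli formula for multiparameter Schur functions. -/
theorem schur_eq_det_hook (a : ℤ → ℂ) (μ : YoungDiagram) :
    schur a μ = (Matrix.of fun i j : Fin (depth μ) => hook a (arm μ i) (leg μ j)).det := by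
  obtain ⟨n, hn⟩ := Nat.exists_eq_add_of_le (depth_le_colLen μ)
  have hleg : ∀ {i : ℕ}, i < depth μ → leg μ i < depth μ + n := fun hi => hn ▸ leg_lt_colLen μ hi
  rw [schur, hn]
  -- A row i ≥ d of the Jacobi–Trudi matrix is row i - μ_i of `K`. The legs fill the remaining
  -- indices.
  let π₀ : Fin (depth μ + n) → Fin (depth μ + n) := fun i =>
    if h : (i : ℕ) < depth μ then ⟨leg μ i, hleg h⟩
    else ⟨i - μ.rowLen i, (Nat.sub_le _ _).trans_lt i.isLt⟩
  have hπ₀ : Function.Injective π₀ := by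
    intro i j h
    simp only [π₀] at h
    split_ifs at h with hi hj hj
    · by_contra hne
      rcases lt_or_gt_of_ne hne with h' | h'
      · exact (leg_lt_leg μ h' (hj)).ne' (congrArg Fin.val h)
      · exact (leg_lt_leg μ h' (hi)).ne (congrArg Fin.val h)
    · exact absurd (congrArg Fin.val h).symm
        (sub_rowLen_ne_leg μ (not_lt.mp hj) (hi))
    · exact absurd (congrArg Fin.val h)
        (sub_rowLen_ne_leg μ (not_lt.mp hi) (hj))
    · have h' := congrArg Fin.val h
      have hi' := rowLen_le_of_depth_le μ (not_lt.mp hi : depth μ ≤ i)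
      have hj' := rowLen_le_of_depth_le μ (not_lt.mp hj : depth μ ≤ j)
      simp only at h'
      refine Fin.ext ?_
      rcases le_total (i : ℕ) j with hij | hij
      · have := μ.rowLen_anti i j hij
        omega
      · have := μ.rowLen_anti j i hij
        omega
  let π : Equiv.Perm (Fin (depth μ + n)) := Equiv.ofBijective π₀ (Finite.injective_iff_bijective.mp hπ₀)
  have hπ : ∀ i, π i = π₀ i := fun i => rfl
  let Y : Matrix (Fin (depth μ + n)) (Fin (depth μ + n)) SymFun := Matrix.of fun i k =>
    if (i : ℕ) < depth μ then (-1) ^ (k : ℕ) * hook a (arm μ i) k else if k = π i then 1 else 0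
  let K : Matrix (Fin (depth μ + n)) (Fin (depth μ + n)) SymFun :=
    Matrix.of fun k j => row (shift (-(j : ℤ)) a) ((j : ℤ) - k)
  have hYK : (Matrix.of fun i j : Fin (depth μ + n) =>
      row (shift (-(j : ℤ)) a) ((μ.rowLen i : ℤ) - (i : ℤ) + (j : ℤ))) = Y * K := by
    ext1 i j
    rw [Matrix.mul_apply]
    simp only [Y, K, Matrix.of_apply]
    split_ifs with hi
    · rw [rowLen_eq_arm μ (hi),
        show (((i + 1 + arm μ i : ℕ) : ℤ) - i + j) = (arm μ i : ℤ) + 1 + j by push_cast; ring,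
        row_shift_eq_sum,
        Fin.sum_univ_eq_sum_range (fun k => ((-1) ^ k * hook a (arm μ i) k) *
          row (shift (-(j : ℤ)) a) ((j : ℤ) - k)) (depth μ + n)]
      -- The sum over k ≤ j extends to all k because `K` vanishes below the diagonal.
      refine Finset.sum_subset (fun k hk => ?_) fun k _ hk => ?_
      · have := Finset.mem_range.mp hk
        have := j.isLt
        exact Finset.mem_range.mpr (by omega)
      · have := mt Finset.mem_range.mpr hk
        rw [row_of_neg _ (by omega), mul_zero]
    · have hi' := rowLen_le_of_depth_le μ (not_lt.mp hi : depth μ ≤ i)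
      simp only [ite_mul, one_mul, zero_mul, Finset.sum_ite_eq',
        Finset.mem_univ, if_true]
      rw [hπ, show π₀ i = ⟨i - μ.rowLen i, (Nat.sub_le _ _).trans_lt i.isLt⟩ from dif_neg hi]
      congr 1
      simp only
      omega
  have hK : K.det = 1 := det_row_shift a (depth μ + n)
  rw [hYK, Matrix.det_mul, hK, mul_one, det_eq_of_unit_rows Y π]
  · have e : ∀ i : Fin (depth μ), (π (Fin.castAdd n i) : ℕ) = leg μ i := fun i => by
      rw [hπ]
      simp [π₀]
    have e2 : (Matrix.of fun i j : Fin (depth μ) => Y (Fin.castAdd n i) (π (Fin.castAdd n j))) =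
        Matrix.of fun i j : Fin (depth μ) => (-1) ^ leg μ j *
          (Matrix.of fun i j : Fin (depth μ) => hook a (arm μ i) (leg μ j)) i j := by
      ext1 i j
      simp [Y, e]
    -- The column signs (-1)^leg of `Y` cancel the sign of π.
    rw [e2, Matrix.det_mul_row]
    simp only [e]
    rw [← mul_assoc, ← Finset.prod_mul_distrib]
    simp [← mul_pow]
  · intro i j hij hj
    rw [hπ, hπ, show π₀ i = ⟨leg μ i, hleg ((Fin.lt_def.mp hij).trans hj)⟩ from
      dif_pos ((Fin.lt_def.mp hij).trans hj), show π₀ j = ⟨leg μ j, hleg hj⟩ from dif_pos hj]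
    exact leg_lt_leg μ hij (hj)
  · intro i j hij hi
    have hij' : (i : ℕ) < j := hij
    have hi' := rowLen_le_of_depth_le μ (hi : depth μ ≤ i)
    have := μ.rowLen_anti i j hij'.le
    rw [hπ, hπ, show π₀ i = ⟨i - μ.rowLen i, (Nat.sub_le _ _).trans_lt i.isLt⟩ from
        dif_neg (by omega),
      show π₀ j = ⟨j - μ.rowLen j, (Nat.sub_le _ _).trans_lt j.isLt⟩ from
        dif_neg (by omega)]
    simp only [Fin.mk_lt_mk]
    omega
  · intro i k
    simp [Y]

end Giambelli

/-! ### The Cauchy–Binet formula. -/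

section CauchyBinet

variable {R : Type*} [CommRing R]

open scoped Classical in
-- Sorting in decreasing order writes an injective f uniquely as g ∘ τ; g is determined by the range
-- of f.
theorem sum_injective_eq_sum_strictAnti {d M : ℕ} (F : (Fin d → Fin M) → R) :
    ∑ f with Function.Injective f, F f =
      ∑ g with StrictAnti g, ∑ τ : Equiv.Perm (Fin d), F (g ∘ τ) := by
  rw [← Finset.sum_product']
  symm
  refine Finset.sum_bij (fun x _ => x.1 ∘ x.2) ?_ ?_ ?_ fun _ _ => rfl
  · rintro ⟨g, τ⟩ h
    simp only [Finset.mem_product, Finset.mem_filter, Finset.mem_univ, true_and, and_true] at h ⊢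
    exact h.injective.comp τ.injective
  · rintro ⟨g, τ⟩ h ⟨g', τ'⟩ h' heq
    simp only [Finset.mem_product, Finset.mem_filter, Finset.mem_univ, true_and, and_true]
      at h h' heq
    have hg : g = g' := by
      refine (h.range_inj h').mp ?_
      rw [← τ.surjective.range_comp g, ← τ'.surjective.range_comp g', heq]
    subst hg
    refine Prod.ext rfl (Equiv.ext fun i => ?_)
    exact h.injective (congrFun heq i)
  · intro f hf
    have hf := (Finset.mem_filter.mp hf).2
    let τ := Tuple.sort (OrderDual.toDual ∘ f)
    have hm : Monotone ((OrderDual.toDual ∘ f) ∘ τ) := Tuple.monotone_sort _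
    have ha : StrictAnti (f ∘ τ) :=
      (show Antitone (f ∘ τ) from fun i j hij => hm hij).strictAnti_of_injective
        (hf.comp τ.injective)
    refine ⟨(f ∘ τ, τ.symm), ?_, ?_⟩
    · simpa using ha
    · ext i
      simp

open scoped Classical in
/-- The Cauchy–Binet formula, over strictly decreasing sequences of indices. -/
theorem det_mul_eq_sum_strictAnti {d M : ℕ} (A : Matrix (Fin d) (Fin M) R)
    (B : Matrix (Fin M) (Fin d) R) :
    (A * B).det = ∑ f with StrictAnti f, (A.submatrix id f).det * (B.submatrix f id).det := by
  have h1 : (A * B).det =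
      ∑ f : Fin d → Fin M, (A.submatrix id f).det * ∏ i, B (f i) i := by
    simp only [Matrix.det_apply', Matrix.mul_apply, Finset.prod_univ_sum, Fintype.piFinset_univ,
      Finset.mul_sum, Finset.sum_mul]
    rw [Finset.sum_comm]
    refine Finset.sum_congr rfl fun f _ => Finset.sum_congr rfl fun σ _ => ?_
    rw [Finset.prod_mul_distrib, mul_assoc]
    rfl
  have h2 : ∑ f : Fin d → Fin M, (A.submatrix id f).det * ∏ i, B (f i) i =
      ∑ f with Function.Injective f, (A.submatrix id f).det * ∏ i, B (f i) i := by
    symm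
    refine Finset.sum_subset (Finset.subset_univ _) fun f _ hf => ?_
    have hf : ¬ Function.Injective f := by simpa using hf
    rw [Function.not_injective_iff] at hf
    obtain ⟨i, j, hij, hne⟩ := hf
    rw [Matrix.det_zero_of_column_eq hne fun k => by simp [hij], zero_mul]
  rw [h1, h2, sum_injective_eq_sum_strictAnti]
  refine Finset.sum_congr rfl fun g _ => ?_
  rw [Matrix.det_apply' (B.submatrix g id), Finset.mul_sum]
  refine Finset.sum_congr rfl fun τ _ => ?_
  have : A.submatrix id (g ∘ τ) = (A.submatrix id g).submatrix id τ := rfl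
  rw [this, Matrix.det_permute']
  simp only [Matrix.submatrix_apply, id, Function.comp_apply]
  ring

end CauchyBinet

/-! ### The expansion and its coefficients. -/

section Expansion

/-- The entries in rows ≥ i and columns ≤ i all vanish. By pigeonhole every permutation sends some k
≤ i to a value ≥ i, so it meets this block. -/
theorem coeffDet_eq_zero (a b : ℤ → ℂ) {d : ℕ} {p p' : ℕ → ℕ}
    (hp : ∀ i j, i < j → j < d → p j < p i) (hp' : ∀ i j, i < j → j < d → p' j < p' i)
    {i : ℕ} (hi : i < d) (h : p i < p' i) : coeffDet a b d p p' = 0 := by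
  rw [coeffDet, Matrix.det_apply']
  refine Finset.sum_eq_zero fun σ _ => ?_
  obtain ⟨k, hk, hσ⟩ : ∃ k : Fin d, (k : ℕ) ≤ i ∧ i ≤ σ k := by
    by_contra! hcon
    have hsub : (Finset.Iic (⟨i, hi⟩ : Fin d)).image σ ⊆ Finset.Iio (⟨i, hi⟩ : Fin d) := by
      intro v hv
      obtain ⟨k, hk, rfl⟩ := Finset.mem_image.mp hv
      exact Finset.mem_Iio.mpr (Fin.lt_def.mpr (hcon k (Fin.le_def.mp (Finset.mem_Iic.mp hk))))
    have := Finset.card_le_card hsub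
    rw [Finset.card_image_of_injective _ σ.injective, Fin.card_Iic, Fin.card_Iio] at this
    simp only at this
    omega
  have h1 : p (σ k) ≤ p i := by
    rcases hσ.eq_or_lt with e | e
    · rw [← e]
    · exact (hp _ _ e (σ k).isLt).le
  have h2 : p' i ≤ p' k := by
    rcases hk.eq_or_lt with e | e
    · rw [← e]
    · exact (hp' _ _ e hi).le
  rw [Finset.prod_eq_zero (Finset.mem_univ k) (hookCoeff_of_lt a b (by omega)), mul_zero]

theorem coeffDet_self (a b : ℤ → ℂ) {d : ℕ} {p : ℕ → ℕ}
    (hp : ∀ i j, i < j → j < d → p j < p i) : coeffDet a b d p p = 1 := by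
  rw [coeffDet, Matrix.det_of_isUpperTriangular]
  · simp [hookCoeff_self]
  · intro i j h
    exact hookCoeff_of_lt a b (hp _ _ h i.isLt)

theorem schur_eq_det_hook_of_depth_eq (a : ℤ → ℂ) {ν : YoungDiagram} {d : ℕ}
    (h : depth ν = d) :
    schur a ν = (Matrix.of fun i j : Fin d => hook a (arm ν i) (leg ν j)).det := by
  subst h
  exact schur_eq_det_hook a ν

theorem arm_lt_rowLen (μ : YoungDiagram) {i : ℕ} (hi : i < depth μ) : arm μ i < μ.rowLen 0 := by
  have := rowLen_eq_arm μ hi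
  have := μ.rowLen_anti 0 i (Nat.zero_le _)
  omega

open scoped Classical in
theorem schur_eq_sum_strictAnti (a b : ℤ → ℂ) (μ : YoungDiagram) {M : ℕ}
    (hM : ∀ i < depth μ, arm μ i < M ∧ leg μ i < M) :
    schur a μ = ∑ f : Fin (depth μ) → Fin M with StrictAnti f,
      ∑ g : Fin (depth μ) → Fin M with StrictAnti g,
      ((Matrix.of fun i j : Fin (depth μ) => hookCoeff a b (arm μ i) (f j)).det *
        (Matrix.of fun i j : Fin (depth μ) =>
          hookCoeff (dual a) (dual b) (leg μ i) (g j)).det) •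
        (Matrix.of fun i j : Fin (depth μ) => hook b (f i) (g j)).det := by
  let ι : ℂ →+* SymFun := MvPolynomial.C
  let A : Matrix (Fin (depth μ)) (Fin M) SymFun :=
    Matrix.of fun i k => ι (hookCoeff a b (arm μ i) k)
  let S : Matrix (Fin M) (Fin M) SymFun := Matrix.of fun k l => hook b k l
  let D : Matrix (Fin M) (Fin (depth μ)) SymFun :=
    Matrix.of fun l j => ι (hookCoeff (dual a) (dual b) (leg μ j) l)
  have hfac : (Matrix.of fun i j : Fin (depth μ) => hook a (arm μ i) (leg μ j)) =
      A * (S * D) := by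
    ext1 i j
    have hi := (hM i i.isLt).1
    have hj := (hM j j.isLt).2
    simp only [Matrix.mul_apply, A, S, D, Matrix.of_apply, Finset.mul_sum]
    rw [hook_eq_sum a b]
    rw [Fin.sum_univ_eq_sum_range (fun k : ℕ => ∑ l : Fin M, ι (hookCoeff a b (arm μ i) k) *
      (hook b k l * ι (hookCoeff (dual a) (dual b) (leg μ j) l))) M]
    refine (Finset.sum_congr rfl fun k _ => ?_).trans (Finset.sum_subset
      (Finset.range_subset_range.mpr hi) fun k _ hk => ?_)
    · rw [Fin.sum_univ_eq_sum_range (fun l : ℕ => ι (hookCoeff a b (arm μ i) k) *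
        (hook b k l * ι (hookCoeff (dual a) (dual b) (leg μ j) l))) M]
      refine (Finset.sum_congr rfl fun l _ => ?_).trans (Finset.sum_subset
        (Finset.range_subset_range.mpr hj) fun l _ hl => ?_)
      · rw [MvPolynomial.smul_eq_C_mul, map_mul]
        ring
      · rw [hookCoeff_of_lt (dual a) (dual b) (by have := mt Finset.mem_range.mpr hl; omega)]
        simp
    · rw [hookCoeff_of_lt _ _ (by have := mt Finset.mem_range.mpr hk; omega)]
      simp
  rw [schur_eq_det_hook, hfac, det_mul_eq_sum_strictAnti]
  refine Finset.sum_congr rfl fun f _ => ?_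
  have e : (S * D).submatrix f id = S.submatrix f id * D := rfl
  rw [e, det_mul_eq_sum_strictAnti, Finset.mul_sum]
  refine Finset.sum_congr rfl fun g _ => ?_
  have hA : (A.submatrix id f).det =
      ι (Matrix.of fun i j : Fin (depth μ) => hookCoeff a b (arm μ i) (f j)).det := by
    rw [RingHom.map_det]
    rfl
  have hD : (D.submatrix g id).det = ι (Matrix.of fun i j : Fin (depth μ) =>
      hookCoeff (dual a) (dual b) (leg μ i) (g j)).det := by
    rw [RingHom.map_det, ← Matrix.det_transpose]
    rfl
  rw [hA, hD, MvPolynomial.smul_eq_C_mul, map_mul]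
  have hS : (S.submatrix f id).submatrix id g =
      Matrix.of fun i j : Fin (depth μ) => hook b (f i) (g j) := rfl
  rw [hS]
  ring

theorem exists_expansion (a b : ℤ → ℂ) (μ : YoungDiagram) :
    ∃ c : YoungDiagram →₀ ℂ, IsExpansion a b μ c ∧ (∀ ν, depth ν ≠ depth μ → c ν = 0) ∧
      ∀ ν, depth ν = depth μ → c ν = coeffDet a b (depth μ) (arm μ) (arm ν) *
        coeffDet (dual a) (dual b) (depth μ) (leg μ) (leg ν) := by
  classical
  obtain ⟨M, hM⟩ : ∃ M, ∀ i < depth μ, arm μ i < M ∧ leg μ i < M :=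
    ⟨μ.rowLen 0 + μ.colLen 0, fun i hi => by
      have := arm_lt_rowLen μ hi
      have := leg_lt_colLen μ hi
      omega⟩
  have hex : ∀ f g : Fin (depth μ) → Fin M, ∃ ν : YoungDiagram, StrictAnti f → StrictAnti g →
      depth ν = depth μ ∧ ∀ i : Fin (depth μ), arm ν i = f i ∧ leg ν i = g i := by
    intro f g
    by_cases h : StrictAnti f ∧ StrictAnti g
    · obtain ⟨ν, hν⟩ := exists_frobenius (p := fun i => (f i : ℕ)) (q := fun i => (g i : ℕ))
        (fun i j hij => h.1 hij) (fun i j hij => h.2 hij)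
      exact ⟨ν, fun _ _ => hν⟩
    -- A default value; the sums only run over strictly decreasing pairs.
    · exact ⟨⊥, fun hf hg => absurd ⟨hf, hg⟩ h⟩
  choose Φ hΦ using hex
  let w : (Fin (depth μ) → Fin M) → (Fin (depth μ) → Fin M) → ℂ := fun f g =>
    (Matrix.of fun i j : Fin (depth μ) => hookCoeff a b (arm μ i) (f j)).det *
      (Matrix.of fun i j : Fin (depth μ) => hookCoeff (dual a) (dual b) (leg μ i) (g j)).det
  let c : YoungDiagram →₀ ℂ := ∑ f with StrictAnti f, ∑ g with StrictAnti g,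
    Finsupp.single (Φ f g) (w f g)
  have hc : ∀ ν, c ν = ∑ f with StrictAnti f, ∑ g with StrictAnti g,
      if Φ f g = ν then w f g else 0 := by
    intro ν
    simp only [c, Finsupp.finsetSum_apply, Finsupp.single_apply]
  refine ⟨c, ?_, ?_, ?_⟩
  · rw [IsExpansion, ← Finsupp.linearCombination_apply, schur_eq_sum_strictAnti a b μ hM, map_sum]
    refine Finset.sum_congr rfl fun f hf => ?_
    rw [map_sum]
    refine Finset.sum_congr rfl fun g hg => ?_
    obtain ⟨h1, h2⟩ := hΦ f g (Finset.mem_filter.mp hf).2 (Finset.mem_filter.mp hg).2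
    rw [Finsupp.linearCombination_single, schur_eq_det_hook_of_depth_eq b h1]
    simp only [h2, w]
  · intro ν hν
    rw [hc]
    refine Finset.sum_eq_zero fun f hf => Finset.sum_eq_zero fun g hg => if_neg ?_
    rintro rfl
    exact hν (hΦ f g (Finset.mem_filter.mp hf).2 (Finset.mem_filter.mp hg).2).1
  · intro ν hν
    rw [hc]
    by_cases hr : ∀ i < depth μ, arm ν i < M ∧ leg ν i < M
    · let f₀ : Fin (depth μ) → Fin M := fun i => ⟨arm ν i, (hr i i.isLt).1⟩
      let g₀ : Fin (depth μ) → Fin M := fun i => ⟨leg ν i, (hr i i.isLt).2⟩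
      have hf₀ : StrictAnti f₀ := fun i j hij => arm_lt_arm ν hij (j.isLt.trans_eq hν.symm)
      have hg₀ : StrictAnti g₀ := fun i j hij => leg_lt_leg ν hij (j.isLt.trans_eq hν.symm)
      have huniq : ∀ f g, StrictAnti f → StrictAnti g → Φ f g = ν → f = f₀ ∧ g = g₀ := by
        rintro f g hf hg rfl
        have h := (hΦ f g hf hg).2
        exact ⟨funext fun i => Fin.ext (h i).1.symm, funext fun i => Fin.ext (h i).2.symm⟩
      have heq : Φ f₀ g₀ = ν := by
        obtain ⟨h1, h2⟩ := hΦ f₀ g₀ hf₀ hg₀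
        refine le_antisymm (le_of_arm_le_of_leg_le (h1.trans hν.symm)
          (fun i hi => (h2 ⟨i, hν ▸ hi⟩).1.le) fun i hi => (h2 ⟨i, hν ▸ hi⟩).2.le)
          (le_of_arm_le_of_leg_le (hν.trans h1.symm)
          (fun i hi => (h2 ⟨i, h1 ▸ hi⟩).1.ge) fun i hi => (h2 ⟨i, h1 ▸ hi⟩).2.ge)
      rw [Finset.sum_eq_single f₀, Finset.sum_eq_single g₀, if_pos heq]
      · rfl
      · intro g hg hne
        exact if_neg fun h => hne (huniq _ _ hf₀ (Finset.mem_filter.mp hg).2 h).2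
      · exact fun h => absurd (Finset.mem_filter.mpr ⟨Finset.mem_univ _, hg₀⟩) h
      · intro f hf hne
        exact Finset.sum_eq_zero fun g hg => if_neg fun h =>
          hne (huniq _ _ (Finset.mem_filter.mp hf).2 (Finset.mem_filter.mp hg).2 h).1
      · exact fun h => absurd (Finset.mem_filter.mpr ⟨Finset.mem_univ _, hf₀⟩) h
    -- Here ν has a coordinate ≥ M, beyond every coordinate of μ. It is not of the form `Φ f g` in
    -- the sum, and the determinant formula gives 0 as well.
    · have hz : coeffDet a b (depth μ) (arm μ) (arm ν) *
          coeffDet (dual a) (dual b) (depth μ) (leg μ) (leg ν) = 0 := by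
        push Not at hr
        obtain ⟨i, hi, h⟩ := hr
        obtain ⟨h1, h2⟩ := hM i hi
        by_cases h3 : arm ν i < M
        · rw [mul_eq_zero]
          exact Or.inr (coeffDet_eq_zero _ _ (fun _ _ => leg_lt_leg μ)
            (fun i j hij hj => leg_lt_leg ν hij (hν ▸ hj)) hi (h2.trans_le (h h3)))
        · rw [mul_eq_zero]
          exact Or.inl (coeffDet_eq_zero _ _ (fun _ _ => arm_lt_arm μ)
            (fun i j hij hj => arm_lt_arm ν hij (hν ▸ hj)) hi (h1.trans_le (not_lt.mp h3)))
      rw [hz]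
      refine Finset.sum_eq_zero fun f hf => Finset.sum_eq_zero fun g hg => if_neg ?_
      rintro rfl
      have h := (hΦ f g (Finset.mem_filter.mp hf).2 (Finset.mem_filter.mp hg).2).2
      refine hr fun i hi => ?_
      have := h ⟨i, hi⟩
      simp only at this
      rw [this.1, this.2]
      exact ⟨Fin.isLt _, Fin.isLt _⟩

end Expansion

/-! ### Linear independence of the Schur functions. -/

section LinearIndependence

theorem rowLen_eq_zero_of_colLen_le (ν : YoungDiagram) {i : ℕ} (h : ν.colLen 0 ≤ i) :
    ν.rowLen i = 0 := by
  by_contra h0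
  have := YoungDiagram.mem_iff_lt_colLen.mp
    (YoungDiagram.mem_iff_lt_rowLen.mpr (Nat.pos_of_ne_zero h0))
  omega

/-- Empty rows add a unitriangular block. Finitely many diagrams can thus share one matrix size. -/
theorem schur_eq_det_of_colLen_le (a : ℤ → ℂ) (ν : YoungDiagram) {N : ℕ}
    (h : ν.colLen 0 ≤ N) :
    schur a ν = (Matrix.of fun i j : Fin N =>
      row (shift (-(j : ℤ)) a) ((ν.rowLen i : ℤ) - (i : ℤ) + (j : ℤ))).det := by
  obtain ⟨n, rfl⟩ := Nat.exists_eq_add_of_le h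
  rw [det_eq_mul_of_lower_left_zero, Matrix.det_of_isUpperTriangular
    (M := (Matrix.submatrix _ (Fin.natAdd (ν.colLen 0)) (Fin.natAdd (ν.colLen 0))))]
  · have : ∀ i : Fin n, ν.rowLen (ν.colLen 0 + i) = 0 := fun i =>
      rowLen_eq_zero_of_colLen_le ν (Nat.le_add_right _ _)
    simp only [Matrix.submatrix_apply, Matrix.of_apply, Fin.val_natAdd, this]
    simp only [Nat.cast_zero, zero_sub, neg_add_cancel, row_zero, Finset.prod_const_one, mul_one]
    rfl
  · intro i j hij
    have hij' : (j : ℕ) < i := hij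
    simp only [Matrix.submatrix_apply, Matrix.of_apply, Fin.val_natAdd]
    rw [rowLen_eq_zero_of_colLen_le ν (Nat.le_add_right _ _)]
    exact row_of_neg _ (by push_cast; omega)
  · intro i j
    have := j.isLt
    simp only [Matrix.of_apply, Fin.val_natAdd, Fin.val_castAdd]
    rw [rowLen_eq_zero_of_colLen_le ν (Nat.le_add_right _ _)]
    exact row_of_neg _ (by push_cast; omega)

theorem rowNat_zero_left (n : ℕ) : rowNat 0 n = complete n := by
  cases n with
  | zero => rw [rowNat_zero, complete_zero]
  | succ n => rw [rowNat_succ, factorialPower_zero_left, residue_X_pow]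

/-- The homomorphism from symmetric functions to polynomials in `N` variables. -/
def toMvPolynomial (N : ℕ) : SymFun →ₐ[ℂ] MvPolynomial (Fin N) ℂ :=
  MvPolynomial.aeval fun k : ℕ+ => ∑ i, MvPolynomial.X i ^ (k : ℕ)

/-- The coefficients of `∏_{i ≠ k} (1 - x_i t)`. -/
def elementaryCoeff {N : ℕ} (k : Fin N) (l : ℕ) : MvPolynomial (Fin N) ℂ :=
  PowerSeries.coeff l (∏ i ∈ Finset.univ.erase k,
    (1 - PowerSeries.C (MvPolynomial.X i : MvPolynomial (Fin N) ℂ) * PowerSeries.X))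

/-- In N variables, H(t) times the product of 1 - x_i t over i ≠ k is 1/(1 - x_k t). -/
theorem sum_complete_mul_elementaryCoeff {N : ℕ} (k : Fin N) (m : ℕ) :
    ∑ l ∈ Finset.range (m + 1), toMvPolynomial N (complete (m - l)) * elementaryCoeff k l =
      MvPolynomial.X k ^ m := by
  have h1 := map_completeSeries_mul (R := MvPolynomial (Fin N) ℂ) Finset.univ
    (∅ : Finset Empty) (fun i => MvPolynomial.X i) (fun _ => 0) (toMvPolynomial N)
    (fun l => by simp [toMvPolynomial])
  rw [Finset.prod_empty, ← Finset.mul_prod_erase _ _ (Finset.mem_univ k)] at h1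
  have h2 : (1 - PowerSeries.C (MvPolynomial.X k : MvPolynomial (Fin N) ℂ) * PowerSeries.X) *
      PowerSeries.mk (fun n => (MvPolynomial.X k : MvPolynomial (Fin N) ℂ) ^ n) = 1 := by
    ext1 n
    rw [sub_mul, one_mul, mul_assoc, map_sub, PowerSeries.coeff_C_mul]
    cases n with
    | zero => simp
    | succ n => simp [PowerSeries.coeff_succ_X_mul, PowerSeries.coeff_one, pow_succ, mul_comm]
  have h3 : (∏ i ∈ Finset.univ.erase k, (1 - PowerSeries.C
      (MvPolynomial.X i : MvPolynomial (Fin N) ℂ) * PowerSeries.X)) *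
      PowerSeries.map (toMvPolynomial N : SymFun →+* MvPolynomial (Fin N) ℂ) completeSeries =
      PowerSeries.mk fun n => (MvPolynomial.X k : MvPolynomial (Fin N) ℂ) ^ n := by
    linear_combination -(PowerSeries.map
      (toMvPolynomial N : SymFun →+* MvPolynomial (Fin N) ℂ) completeSeries *
      ∏ i ∈ Finset.univ.erase k, (1 - PowerSeries.C
      (MvPolynomial.X i : MvPolynomial (Fin N) ℂ) * PowerSeries.X)) * h2 +
      PowerSeries.mk (fun n => (MvPolynomial.X k : MvPolynomial (Fin N) ℂ) ^ n) * h1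
  have h4 := congrArg (PowerSeries.coeff m) h3
  rw [PowerSeries.coeff_mk, PowerSeries.coeff_mul,
    Finset.Nat.sum_antidiagonal_eq_sum_range_succ_mk] at h4
  rw [← h4]
  refine Finset.sum_congr rfl fun l _ => ?_
  rw [mul_comm, PowerSeries.coeff_map]
  rfl

/-- The exponent `ν_i + N - 1 - i` of the alternant of `ν`. -/
def alternantExponent (N : ℕ) (ν : YoungDiagram) (i : Fin N) : ℕ := ν.rowLen i + (N - 1 - i)

theorem strictAnti_alternantExponent (N : ℕ) (ν : YoungDiagram) :
    StrictAnti (alternantExponent N ν) := by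
  intro i j hij
  have hij' : (i : ℕ) < j := hij
  have := ν.rowLen_anti i j hij'.le
  have := j.isLt
  simp only [alternantExponent]
  omega

/-- The Jacobi–Trudi determinant times a factor independent of `ν` is the alternant. -/
theorem toMvPolynomial_schur_mul {N : ℕ} (ν : YoungDiagram) (h : ν.colLen 0 ≤ N) :
    toMvPolynomial N (schur 0 ν) *
      (Matrix.of fun j k : Fin N => elementaryCoeff k (N - 1 - j)).det =
      (Matrix.of fun i k : Fin N =>
        (MvPolynomial.X k : MvPolynomial (Fin N) ℂ) ^ alternantExponent N ν i).det := by
  rw [schur_eq_det_of_colLen_le 0 ν h, AlgHom.map_det, ← Matrix.det_mul]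
  congr 1
  ext1 i k
  rw [Matrix.mul_apply]
  simp only [AlgHom.mapMatrix_apply, Matrix.map_apply, Matrix.of_apply]
  have hs : ∀ j : ℤ, shift j 0 = 0 := fun j => rfl
  simp only [hs]
  rw [Fin.sum_univ_eq_sum_range (fun j : ℕ => toMvPolynomial N
    (row 0 ((ν.rowLen i : ℤ) - (i : ℤ) + (j : ℤ))) * elementaryCoeff k (N - 1 - j)) N,
    ← Finset.sum_range_reflect, ← sum_complete_mul_elementaryCoeff]
  have hi := i.isLt
  -- Both sums are truncations of the sum of `F`, which vanishes for l ≥ N by degree and for l above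
  -- the exponent because the row index is negative.
  let F : ℕ → MvPolynomial (Fin N) ℂ := fun l =>
    toMvPolynomial N (row 0 ((alternantExponent N ν i : ℤ) - l)) * elementaryCoeff k l
  have hl : ∀ l ∈ Finset.range N, toMvPolynomial N
      (row 0 ((ν.rowLen i : ℤ) - (i : ℤ) + ((N - 1 - l : ℕ) : ℤ))) *
        elementaryCoeff k (N - 1 - (N - 1 - l)) = F l := by
    intro l hl
    have := Finset.mem_range.mp hl
    simp only [F, alternantExponent]
    congr 3
    · push_cast
      omega
    · omega
  have hr : ∀ l ∈ Finset.range (alternantExponent N ν i + 1), toMvPolynomial N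
      (complete (alternantExponent N ν i - l)) * elementaryCoeff k l = F l := by
    intro l hl
    have := Finset.mem_range.mp hl
    simp only [F]
    rw [← rowNat_zero_left, ← Nat.cast_sub (by omega)]
    rfl
  rw [Finset.sum_congr rfl hl, Finset.sum_congr rfl hr]
  have hF1 : ∀ l, N ≤ l → F l = 0 := by
    intro l hl
    simp only [F, elementaryCoeff]
    rw [coeff_prod_one_sub_eq_zero, mul_zero]
    rw [Finset.card_erase_of_mem (Finset.mem_univ k), Finset.card_univ, Fintype.card_fin]
    omega
  have hF2 : ∀ l, alternantExponent N ν i < l → F l = 0 := by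
    intro l hl
    simp only [F]
    rw [row_of_neg _ (by omega), map_zero, zero_mul]
  rcases le_total N (alternantExponent N ν i + 1) with h' | h'
  · exact Finset.sum_subset (Finset.range_subset_range.mpr h') fun l _ hl =>
      hF1 l (not_lt.mp (mt Finset.mem_range.mpr hl))
  · exact (Finset.sum_subset (Finset.range_subset_range.mpr h') fun l _ hl =>
      hF2 l (by have := mt Finset.mem_range.mpr hl; omega)).symm

theorem eq_of_alternantExponent_eq {N : ℕ} {ν κ : YoungDiagram} (hν : ν.colLen 0 ≤ N)
    (hκ : κ.colLen 0 ≤ N) (h : alternantExponent N ν = alternantExponent N κ) : ν = κ := by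
  have hr : ∀ i, ν.rowLen i = κ.rowLen i := by
    intro i
    by_cases hi : i < N
    · exact Nat.add_right_cancel (congrFun h ⟨i, hi⟩)
    · rw [rowLen_eq_zero_of_colLen_le ν (by omega), rowLen_eq_zero_of_colLen_le κ (by omega)]
  ext ⟨i, j⟩
  rw [YoungDiagram.mem_cells, YoungDiagram.mem_cells, YoungDiagram.mem_iff_lt_rowLen,
    YoungDiagram.mem_iff_lt_rowLen, hr]

open scoped Classical in
-- Two strictly decreasing exponent sequences that are permutations of each other coincide, so only
-- ν = κ and the identity permutation contribute.
theorem coeff_alternant {N : ℕ} {ν κ : YoungDiagram} (hν : ν.colLen 0 ≤ N)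
    (hκ : κ.colLen 0 ≤ N) :
    MvPolynomial.coeff (Finsupp.equivFunOnFinite.symm (alternantExponent N κ))
      (Matrix.of fun i k : Fin N =>
        (MvPolynomial.X k : MvPolynomial (Fin N) ℂ) ^ alternantExponent N ν i).det =
      if ν = κ then 1 else 0 := by
  have hmon : ∀ e : Fin N → ℕ, ∏ i, (MvPolynomial.X i : MvPolynomial (Fin N) ℂ) ^ e i =
      MvPolynomial.monomial (Finsupp.equivFunOnFinite.symm e) 1 := by
    intro e
    rw [MvPolynomial.monomial_eq, Finsupp.prod_fintype _ _ fun i => pow_zero _]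
    simp
  have hterm : ∀ σ : Equiv.Perm (Fin N), MvPolynomial.coeff
      (Finsupp.equivFunOnFinite.symm (alternantExponent N κ))
      (((Equiv.Perm.sign σ : ℤ) : MvPolynomial (Fin N) ℂ) *
        ∏ i, (MvPolynomial.X i : MvPolynomial (Fin N) ℂ) ^ alternantExponent N ν (σ i)) =
      if alternantExponent N ν ∘ σ = alternantExponent N κ
        then ((Equiv.Perm.sign σ : ℤ) : ℂ) else 0 := by
    intro σ
    rw [hmon fun i => alternantExponent N ν (σ i)]
    have : ((Equiv.Perm.sign σ : ℤ) : MvPolynomial (Fin N) ℂ) =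
        MvPolynomial.C ((Equiv.Perm.sign σ : ℤ) : ℂ) := by simp
    rw [this, MvPolynomial.coeff_C_mul, MvPolynomial.coeff_monomial, mul_ite, mul_one, mul_zero]
    exact if_congr (Finsupp.equivFunOnFinite.symm.injective.eq_iff) rfl rfl
  rw [Matrix.det_apply', MvPolynomial.coeff_sum]
  simp only [Matrix.of_apply, hterm]
  have hcomp : ∀ σ : Equiv.Perm (Fin N), alternantExponent N ν ∘ σ = alternantExponent N κ →
      ν = κ := fun σ h => eq_of_alternantExponent_eq hν hκ
    (((strictAnti_alternantExponent N ν).range_inj (strictAnti_alternantExponent N κ)).mp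
      (by rw [← h, σ.surjective.range_comp]))
  split_ifs with h
  · subst h
    rw [Finset.sum_eq_single 1]
    · simp
    · intro σ _ hσ
      refine if_neg fun h => hσ (Equiv.ext fun i => ?_)
      exact (strictAnti_alternantExponent N ν).injective (congrFun h i)
    · exact fun h => absurd (Finset.mem_univ _) h
  · exact Finset.sum_eq_zero fun σ _ => if_neg fun hσ => h (hcomp σ hσ)

/-- A relation is multiplied by the common factor of `toMvPolynomial_schur_mul` and read off at one
monomial per diagram. Nothing is divided out, so the factor need not be known to be nonzero. -/
theorem linearIndependent_schur_zero : LinearIndependent ℂ (schur 0) := by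
  rw [linearIndependent_iff]
  intro c hc
  ext κ
  by_cases hκ : κ ∈ c.support
  swap
  · simpa using hκ
  obtain ⟨N, hN⟩ : ∃ N, ∀ ν ∈ c.support, ν.colLen 0 ≤ N :=
    ⟨_, fun ν hν => Finset.le_sup (f := fun ν : YoungDiagram => ν.colLen 0) hν⟩
  have h1 := congrArg (fun z => toMvPolynomial N z *
    (Matrix.of fun j k : Fin N => elementaryCoeff k (N - 1 - j)).det) hc
  simp only [Finsupp.linearCombination_apply, Finsupp.sum, map_sum, map_smul, Finset.sum_mul,
    smul_mul_assoc, map_zero, zero_mul] at h1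
  rw [Finset.sum_congr rfl fun ν hν => by rw [toMvPolynomial_schur_mul ν (hN ν hν)]] at h1
  have h2 := congrArg (MvPolynomial.coeff
    (Finsupp.equivFunOnFinite.symm (alternantExponent N κ))) h1
  rw [MvPolynomial.coeff_sum, MvPolynomial.coeff_zero,
    Finset.sum_congr rfl fun ν hν => by
      rw [MvPolynomial.coeff_smul, coeff_alternant (hN ν hν) (hN κ hκ)]] at h2
  rw [Finset.sum_eq_single κ (fun ν _ hν => by simp [hν]) fun h => absurd hκ h] at h2
  simpa using h2

theorem le_of_expansion_ne_zero (a b : ℤ → ℂ) {μ ν : YoungDiagram} (hd : depth ν = depth μ)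
    (h : coeffDet a b (depth μ) (arm μ) (arm ν) *
      coeffDet (dual a) (dual b) (depth μ) (leg μ) (leg ν) ≠ 0) : ν ≤ μ := by
  refine le_of_arm_le_of_leg_le hd (fun i hi => ?_) fun i hi => ?_
  · by_contra hlt
    exact left_ne_zero_of_mul h (coeffDet_eq_zero _ _ (fun _ _ => arm_lt_arm μ)
      (fun i j hij hj => arm_lt_arm ν hij (hj.trans_eq hd.symm)) hi (not_le.mp hlt))
  · by_contra hlt
    exact right_ne_zero_of_mul h (coeffDet_eq_zero _ _ (fun _ _ => leg_lt_leg μ)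
      (fun i j hij hj => leg_lt_leg ν hij (hj.trans_eq hd.symm)) hi (not_le.mp hlt))

theorem linearIndependent_schur (b : ℤ → ℂ) : LinearIndependent ℂ (schur b) := by
  rw [linearIndependent_iff]
  intro c hc
  by_contra hne
  -- At an inclusion-maximal κ of the support, no other term involves `schur 0 κ`, since only
  -- diagrams containing κ can; its coefficient is c κ itself.
  obtain ⟨κ, hκ⟩ := Finset.exists_maximal (Finsupp.support_nonempty_iff.mpr hne)
  choose E hE hE0 hE1 using exists_expansion b 0
  have h1 : Finsupp.linearCombination ℂ (schur 0) (∑ ν ∈ c.support, c ν • E ν) = 0 := by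
    rw [← hc, Finsupp.linearCombination_apply ℂ (v := schur b), map_sum, Finsupp.sum]
    refine Finset.sum_congr rfl fun ν _ => ?_
    rw [map_smul, Finsupp.linearCombination_apply, hE ν]
  have h2 := DFunLike.congr_fun (linearIndependent_iff.mp linearIndependent_schur_zero _ h1) κ
  rw [Finsupp.finsetSum_apply, Finset.sum_eq_single κ] at h2
  · rw [Finsupp.smul_apply, hE1 κ κ rfl, coeffDet_self _ _ fun _ _ => arm_lt_arm κ,
      coeffDet_self _ _ fun _ _ => leg_lt_leg κ] at h2
    exact Finsupp.mem_support_iff.mp hκ.prop (by simpa using h2)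
  · intro ν hν hνκ
    rw [Finsupp.smul_apply, smul_eq_mul]
    refine mul_eq_zero_of_right _ ?_
    by_contra h
    have hd : depth κ = depth ν := by
      by_contra hd
      exact h (hE0 ν κ hd)
    rw [hE1 ν κ hd] at h
    have hle := le_of_expansion_ne_zero b 0 hd h
    exact hνκ (le_antisymm (hκ.le_of_ge hν hle) hle)
  · exact fun h => absurd hκ.prop h

end LinearIndependence

end MultiSchur

end

theorem theorem7p3 (a b : ℤ → ℂ) (μ : YoungDiagram) :
    (∃! c : YoungDiagram →₀ ℂ, MultiSchur.IsExpansion a b μ c) ∧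
    ∀ c : YoungDiagram →₀ ℂ, MultiSchur.IsExpansion a b μ c →
      (∀ ν : YoungDiagram,
        ¬ (ν ≤ μ ∧ MultiSchur.depth ν = MultiSchur.depth μ) → c ν = 0) ∧
      (∀ ν : YoungDiagram, MultiSchur.depth ν = MultiSchur.depth μ →
        c ν =
          MultiSchur.coeffDet a b (MultiSchur.depth μ) (MultiSchur.arm μ) (MultiSchur.arm ν) *
          MultiSchur.coeffDet (MultiSchur.dual a) (MultiSchur.dual b) (MultiSchur.depth μ)
            (MultiSchur.leg μ) (MultiSchur.leg ν)) := by
  obtain ⟨c₀, h₀, hdepth, hcoeff⟩ := MultiSchur.exists_expansion a b μ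
  have huniq : ∀ c, MultiSchur.IsExpansion a b μ c → c = c₀ := by
    intro c hc
    refine MultiSchur.linearIndependent_schur b ?_
    rw [Finsupp.linearCombination_apply, Finsupp.linearCombination_apply]
    exact hc.symm.trans h₀
  refine ⟨⟨c₀, h₀, huniq⟩, fun c hc => ?_⟩
  rw [huniq c hc]
  refine ⟨fun ν hν => ?_, hcoeff⟩
  by_cases hd : MultiSchur.depth ν = MultiSchur.depth μ
  · by_contra h
    rw [hcoeff ν hd] at h
    exact hν ⟨MultiSchur.le_of_expansion_ne_zero a b hd h, hd⟩
  · exact hdepth ν hd
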